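/- Let $\{x_i,x_i^*,y_{i,1},y_{i,2},y_{4,1},y_{4,2}\}_{1\le i\le 3}$ be coordinates on $\mathbb{R}^{14}$. Let $\Phi=\{\phi_{i,j}\}_{1\le i\le 3,\,1\le j\le 2}$ be functions on $\mathbb{R}$ with $\phi_{2,1}(t)=\phi_{2,2}(t)=\phi_{3,1}(t)=\phi_{3,2}(t)=t$ and with $\phi_{1,1},\phi_{1,2}$ real analytic on $\mathbb{R}$, such that $\phi_{1,1}'\phi_{1,2}'=1$ and such that $\phi_{1,1}''$ and $\phi_{1,2}''$ vanish nowhere. Let $\mathcal{M}_\Phi:=(\mathbb{R}^{14},g_\Phi)$ be the pseudo-Riemannian manifold whose non-zero metric components are, up to symmetry, $$g_\Phi(\partial_{x_i},\partial_{x_i^*})=g_\Phi(\partial_{y_{i,1}},\partial_{y_{i,2}})=1\ (1\le i\le 3),$$ $$g_\Phi(\partial_{y_{4,1}},\partial_{y_{4,1}})=g_\Phi(\partial_{y_{4,2}},\partial_{y_{4,2}})=-\tfrac12,\quad g_\Phi(\partial_{y_{4,1}},\partial_{y_{4,2}})=\tfrac14,$$ $$g_\Phi(\partial_{x_1},\partial_{x_1})=-2\phi_{2,1}(x_2)y_{2,1}-2\phi_{3,1}(x_3)y_{3,1},\quad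 g_\Phi(\partial_{x_2},\partial_{x_3})=x_1y_{4,1},$$ $$g_\Phi(\partial_{x_2},\partial_{x_2})=-2\phi_{3,2}(x_3)y_{3,2}-2\phi_{1,2}(x_1)y_{1,2},\quad g_\Phi(\partial_{x_1},\partial_{x_3})=x_2y_{4,2},$$ $$g_\Phi(\partial_{x_3},\partial_{x_3})=-2\phi_{1,1}(x_1)y_{1,1}-2\phi_{2,2}(x_2)y_{2,2}.$$ Define $\Xi=\Xi_\Phi:\mathbb{R}^{14}\to\mathbb{R}$ by evaluating at $x_1$ the function $$\Xi:=\{1-\phi_{1,1}'\,\phi_{1,1}'''\,(\phi_{1,1}'')^{-2}\}^2 .$$ Let $\mathfrak{M}_{14}$ be $\mathbb{R}^{14}$ with a basis $\{\alpha_i,\alpha_i^*,\beta_{i,1},\beta_{i,2},\beta_{4,1},\beta_{4,2}\}_{1\le i\le3}$, the inner product $\langle\cdot,\cdot\rangle$, and the $4$-tensor $A$ whose non-zero components are, up to the symmetries of a metric and the symmetries $A(v_1,v_2,v_3,v_4)=-A(v_2,v_1,v_3,v_4)=A(v_3,v_4,v_1,v_2)$ respectively, $$\langle\alpha_i,\alpha_i^*\rangle=\langle\beta_{i,1},\beta_{i,2}\rangle=1\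 (1\le i\le3),\quad \langle\beta_{4,1},\beta_{4,1}\rangle=\langle\beta_{4,2},\beta_{4,2}\rangle=-\tfrac12,\quad \langle\beta_{4,1},\beta_{4,2}\rangle=\tfrac14,$$ $$A(\alpha_2,\alpha_1,\alpha_1,\beta_{2,1})=A(\alpha_3,\alpha_1,\alpha_1,\beta_{3,1})=A(\alpha_3,\alpha_2,\alpha_2,\beta_{3,2})=1,$$ $$A(\alpha_1,\alpha_2,\alpha_2,\beta_{1,2})=A(\alpha_1,\alpha_3,\alpha_3,\beta_{1,1})=A(\alpha_2,\alpha_3,\alpha_3,\beta_{2,2})=1,$$ $$A(\alpha_1,\alpha_2,\alpha_3,\beta_{4,1})=A(\alpha_1,\alpha_3,\alpha_2,\beta_{4,1})=A(\alpha_2,\alpha_3,\alpha_1,\beta_{4,2})=A(\alpha_2,\alpha_1,\alpha_3,\beta_{4,2})=-\tfrac12 .$$ Then: 1. $\Xi$ is a local isometry invariant: if $\Psi$ is another collection satisfying the same hypotheses, $U\subset\mathbb{R}^{14}$ is open, and $F:U\to\mathbb{R}^{14}$ is a smooth local isometry from $(U,g_\Phi)$ to $(\mathbb{R}^{14},g_\Psi)$,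 then $\Xi_\Psi(F(P))=\Xi_\Phi(P)$ for all $P\in U$. (In particular this holds for $\Psi=\Phi$.) 2. $\mathcal{M}_\Phi$ is $0$-curvature homogeneous with model $\mathfrak{M}_{14}$: for every $P$ there is a linear isomorphism $T_P\mathbb{R}^{14}\to\mathbb{R}^{14}$ that pulls $\langle\cdot,\cdot\rangle$ back to $g_\Phi$ at $P$ and $A$ back to the curvature tensor $R_P$, where $R(X,Y,Z,W)=g_\Phi((\nabla_X\nabla_Y-\nabla_Y\nabla_X-\nabla_{[X,Y]})Z,W)$ and $\nabla$ is the Levi-Civita connection. 3. If there are no real constants $b,c$ with $\phi_{1,1}'(x_1)=be^{cx_1}$ for all $x_1\in\mathbb{R}$, then $\Xi$ is not constant on any non-empty open subset of $\mathbb{R}^{14}$ (in particular it is not locally constant), and $\mathcal{M}_\Phi$ is not locally homogeneous: it is not true that for all points $P,Q$ there is a local isometry of $\mathcal{M}_\Phi$, defined on a neighborhood of $P$, that takes $P$ to $Q$. -/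

import Mathlib

open scoped ContDiff Matrix

noncomputable section

namespace JacobiTsankov

/-! ### Pseudo-Riemannian geometry in global coordinates

A metric on the coordinate space of real vectors indexed by a finite type is given by its
matrix-valued function of components with respect to the coordinate vector fields. -/

section Geometry

/-- The bilinear form with matrix `G`. -/
def formOf {ι : Type} [Fintype ι] (G : Matrix ι ι ℝ) (v w : ι → ℝ) : ℝ :=
  v ⬝ᵥ (G *ᵥ w)

/-- The partial derivative of `f` in the `i`-th coordinate direction at `P`. -/
def pderiv {ι : Type} [Fintype ι] [DecidableEq ι] (i : ι) (f : (ι → ℝ) → ℝ) (P : ι → ℝ) : ℝ :=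
  fderiv ℝ f P (Pi.single i 1)

/-- Christoffel symbols of the Levi-Civita connection of `g`: `christoffel g P k i j` is the
`k`-th component of `∇_{∂_i} ∂_j` at `P`. -/
def christoffel {ι : Type} [Fintype ι] [DecidableEq ι] (g : (ι → ℝ) → Matrix ι ι ℝ)
    (P : ι → ℝ) (k i j : ι) : ℝ :=
  (1 / 2) * ∑ l, (g P)⁻¹ k l *
    (pderiv i (fun Q => g Q j l) P + pderiv j (fun Q => g Q i l) P - pderiv l (fun Q => g Q i j) P)

/-- The `l`-th component at `P` of `ℛ(∂_i, ∂_j) ∂_k`, where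
`ℛ(X, Y) = ∇_X ∇_Y - ∇_Y ∇_X - ∇_[X, Y]`. -/
def curvatureOp {ι : Type} [Fintype ι] [DecidableEq ι] (g : (ι → ℝ) → Matrix ι ι ℝ)
    (P : ι → ℝ) (i j k l : ι) : ℝ :=
  pderiv i (fun Q => christoffel g Q l j k) P - pderiv j (fun Q => christoffel g Q l i k) P
    + ∑ m, (christoffel g P m j k * christoffel g P l i m
      - christoffel g P m i k * christoffel g P l j m)

/-- The curvature tensor `R_P(v₁, v₂, v₃, v₄) = g(ℛ(v₁, v₂) v₃, v₄)`. -/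
def curvature {ι : Type} [Fintype ι] [DecidableEq ι] (g : (ι → ℝ) → Matrix ι ι ℝ)
    (P : ι → ℝ) (v₁ v₂ v₃ v₄ : ι → ℝ) : ℝ :=
  ∑ i, ∑ j, ∑ k, v₁ i * v₂ j * v₃ k * formOf (g P) (fun l => curvatureOp g P i j k l) v₄

/-- `F` is a local isometry from the open set `U`, with the metric `g`, to the coordinate space with
the metric `g'`: it is smooth and pulls `g'` back to `g`. -/
structure IsLocalIsometryOn {ι : Type} [Fintype ι] (g g' : (ι → ℝ) → Matrix ι ι ℝ)
    (F : (ι → ℝ) → (ι → ℝ)) (U : Set (ι → ℝ)) : Prop where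
  isOpen : IsOpen U
  smooth : ContDiffOn ℝ ∞ F U
  pullback : ∀ P ∈ U, ∀ v w : ι → ℝ,
    formOf (g' (F P)) (fderiv ℝ F P v) (fderiv ℝ F P w) = formOf (g P) v w

/-- Local homogeneity: any point is taken to any other by an isometry defined near it.
(For non-degenerate metrics a local isometry is a diffeomorphism onto an open set after
shrinking `U`, so this need not be required separately.) -/
def IsLocallyHomogeneous {ι : Type} [Fintype ι] (g : (ι → ℝ) → Matrix ι ι ℝ) : Prop :=
  ∀ P Q : ι → ℝ, ∃ (U : Set (ι → ℝ)) (F : (ι → ℝ) → (ι → ℝ)),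
    P ∈ U ∧ IsLocalIsometryOn g g F U ∧ F P = Q

/-- `g` is `0`-curvature homogeneous with model `(V, B, A)`: at every point `P` there is a linear
isomorphism from the tangent space to `V` that pulls `B` back to `g_P` and `A` back to `R_P`. -/
def IsZeroCurvatureHomogeneous {ι : Type} [Fintype ι] [DecidableEq ι]
    (g : (ι → ℝ) → Matrix ι ι ℝ) {V : Type} [AddCommGroup V] [Module ℝ V]
    (B : V → V → ℝ) (A : V → V → V → V → ℝ) : Prop :=
  ∀ P : ι → ℝ, ∃ Θ : (ι → ℝ) ≃ₗ[ℝ] V,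
    (∀ v w, B (Θ v) (Θ w) = formOf (g P) v w) ∧
    (∀ v₁ v₂ v₃ v₄, A (Θ v₁) (Θ v₂) (Θ v₃) (Θ v₄) = curvature g P v₁ v₂ v₃ v₄)

end Geometry

/-- Labels of the coordinates on `ℝ¹⁴`. All labels are shifted by one: `x i`, `xs i`, `y i j` stand
for `x_{i+1}`, `x^*_{i+1}`, `y_{i+1,j+1}`. The same labels are used for the basis
`α_{i+1}`, `α^*_{i+1}`, `β_{i+1,j+1}` of the model. -/
inductive Coord : Type
  | x (i : Fin 3)
  | xs (i : Fin 3)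
  | y (i : Fin 4) (j : Fin 2)
  deriving DecidableEq, Fintype

open Coord

/-- The symmetric matrix with `⟨x_i, x_i^*⟩ = ⟨y_{i,1}, y_{i,2}⟩ = 1` for `i ≤ 3`,
`⟨y_{4,1}, y_{4,1}⟩ = ⟨y_{4,2}, y_{4,2}⟩ = -1/2`, `⟨y_{4,1}, y_{4,2}⟩ = 1/4`, with block `S` for the
entries `⟨x_i, x_j⟩`, and all other entries zero. -/
def metricWithBlock (S : Matrix (Fin 3) (Fin 3) ℝ) : Matrix Coord Coord ℝ
  | x i, x j => S i j
  | x i, xs j => if i = j then 1 else 0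
  | xs i, x j => if i = j then 1 else 0
  | y i j, y i' j' =>
      if i = i' then
        if i = 3 then (if j = j' then -1 / 2 else 1 / 4) else (if j = j' then 0 else 1)
      else 0
  | _, _ => 0

/-- The metric `g_Φ` on `ℝ¹⁴`, with `φ i j` standing for `φ_{i+1,j+1}`. -/
def gPhi (φ : Fin 3 → Fin 2 → ℝ → ℝ) (P : Coord → ℝ) : Matrix Coord Coord ℝ :=
  metricWithBlock
    !![-2 * φ 1 0 (P (x 1)) * P (y 1 0) - 2 * φ 2 0 (P (x 2)) * P (y 2 0), 0,
        P (x 1) * P (y 3 1);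
      0, -2 * φ 2 1 (P (x 2)) * P (y 2 1) - 2 * φ 0 1 (P (x 0)) * P (y 0 1),
        P (x 0) * P (y 3 0);
      P (x 1) * P (y 3 1), P (x 0) * P (y 3 0),
        -2 * φ 0 0 (P (x 0)) * P (y 0 0) - 2 * φ 1 1 (P (x 1)) * P (y 1 1)]

/-- The inner product of the model `𝔐₁₄`. -/
def modelForm (v w : Coord → ℝ) : ℝ := formOf (metricWithBlock 0) v w

/-- For distinct pairs `{a, b} ≠ {c, d}`, the tensor with value `1` at the basis vectors
`(e_a, e_b, e_c, e_d)`, extended by the `ℤ₂` symmetries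
`A(v₁,v₂,v₃,v₄) = -A(v₂,v₁,v₃,v₄) = A(v₃,v₄,v₁,v₂)`, and zero on all other basis vectors. -/
def elemCurv (a b c d : Coord) (v₁ v₂ v₃ v₄ : Coord → ℝ) : ℝ :=
  (v₁ a * v₂ b - v₁ b * v₂ a) * (v₃ c * v₄ d - v₃ d * v₄ c)
    + (v₃ a * v₄ b - v₃ b * v₄ a) * (v₁ c * v₂ d - v₁ d * v₂ c)

/-- The algebraic curvature tensor of the model `𝔐₁₄`. -/
def modelCurv (v₁ v₂ v₃ v₄ : Coord → ℝ) : ℝ :=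
  elemCurv (x 1) (x 0) (x 0) (y 1 0) v₁ v₂ v₃ v₄
    + elemCurv (x 2) (x 0) (x 0) (y 2 0) v₁ v₂ v₃ v₄
    + elemCurv (x 2) (x 1) (x 1) (y 2 1) v₁ v₂ v₃ v₄
    + elemCurv (x 0) (x 1) (x 1) (y 0 1) v₁ v₂ v₃ v₄
    + elemCurv (x 0) (x 2) (x 2) (y 0 0) v₁ v₂ v₃ v₄
    + elemCurv (x 1) (x 2) (x 2) (y 1 1) v₁ v₂ v₃ v₄
    - (1 / 2) * elemCurv (x 0) (x 1) (x 2) (y 3 0) v₁ v₂ v₃ v₄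
    - (1 / 2) * elemCurv (x 0) (x 2) (x 1) (y 3 0) v₁ v₂ v₃ v₄
    - (1 / 2) * elemCurv (x 1) (x 2) (x 0) (y 3 1) v₁ v₂ v₃ v₄
    - (1 / 2) * elemCurv (x 1) (x 0) (x 2) (y 3 1) v₁ v₂ v₃ v₄

/-- The specialized collections `Φ`: `φ_{2,j}` and `φ_{3,j}` are the identity, and `φ_{1,1}`,
`φ_{1,2}` are real analytic on `ℝ` with `φ_{1,1}' φ_{1,2}' = 1` and nowhere vanishing second
derivatives. -/
structure IsSpecialized (φ : Fin 3 → Fin 2 → ℝ → ℝ) : Prop where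
  second : ∀ j t, φ 1 j t = t
  third : ∀ j t, φ 2 j t = t
  analytic : ∀ j, AnalyticOnNhd ℝ (φ 0 j) Set.univ
  deriv_mul_deriv : ∀ t, deriv (φ 0 0) t * deriv (φ 0 1) t = 1
  second_deriv_ne_zero : ∀ j t, iteratedDeriv 2 (φ 0 j) t ≠ 0

/-- `Ξ = {1 - φ_{1,1}' φ_{1,1}''' (φ_{1,1}'')⁻²}²`, evaluated at `x₁`, as a function on `ℝ¹⁴`. -/
def Xi (φ : Fin 3 → Fin 2 → ℝ → ℝ) (P : Coord → ℝ) : ℝ :=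
  (1 - deriv (φ 0 0) (P (x 0)) * iteratedDeriv 3 (φ 0 0) (P (x 0))
    / (iteratedDeriv 2 (φ 0 0) (P (x 0))) ^ 2) ^ 2

end JacobiTsankov

end

noncomputable section

set_option linter.unusedSectionVars false

namespace JacobiTsankov

/-! ### Coordinate calculus of partial derivatives. -/

section Calculus

variable {ι κ : Type} [Fintype ι] [DecidableEq ι] [Fintype κ] [DecidableEq κ]

/-! All metrics here belong to one family, `linearMetric T`: the `x`-block is linear in the fibre
coordinates `y`, with coefficients `T` depending on `x`, and everything else is constant. Their
curvature is explicit: besides the components on four `x`-directions (`baseCurv`), only those with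
exactly one `y`-slot (`mixedCurv`) survive.

For the model, a fibre rescaling by `φ_{1,1}'` and `φ_{1,2}'` is an isometry because their product
is 1, and it normalizes the mixed components. Shearing `x` into `y` accounts for the six remaining
base components, and the `x^*`-part of the map is adjusted to keep the metric
(`modelForm_adaptedMap`, `isZeroCurvatureHomogeneous_linearMetric`).

For invariance, the second derivatives of a local isometry are determined by the Christoffel symbols
of both metrics. Equality of mixed third derivatives, together with nondegeneracy of the mixed
curvature, forces the `x`-components of the isometry to be affine functions of `x`, and forces its
fibre Jacobian to be constant and orthogonal; this Jacobian intertwines the curvature vectors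
(`exists_affine`). For `g_Φ` those vectors depend on the point only through `x₁`. Comparing their
inner products at two values of `x₁` shows that `f = φ_{1,1}'` changes by an affine substitution, a
constant factor and possibly inversion `f ↦ 1/f` (`axes_of_form_eq`, `deriv_eq_of_isometry`). Since
`Ξ = ((f/f')')²`, and these operations change `(f/f')'` at most by a sign, `Ξ` is invariant.

If `Ξ` were constant on an open set, analyticity would make `f/f'` affine on the whole line; having
no zero, it would be constant and `f` exponential. Local homogeneity would make `Ξ` constant
everywhere, which is then impossible. -/

theorem fderiv_apply_eq_sum (f : (ι → ℝ) → ℝ) (P v : ι → ℝ) :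
    fderiv ℝ f P v = ∑ i, v i * pderiv i f P := by
  conv_lhs => rw [pi_eq_sum_univ' v]
  simp [pderiv]

theorem pderiv_congr {i : ι} {f f' : (ι → ℝ) → ℝ} {P : ι → ℝ} (h : f =ᶠ[nhds P] f') :
    pderiv i f P = pderiv i f' P := by
  unfold pderiv; rw [h.fderiv_eq]

theorem pderiv_const (i : ι) (c : ℝ) (P : ι → ℝ) : pderiv i (fun _ => c) P = 0 := by
  simp [pderiv]

theorem pderiv_coord (i j : ι) (P : ι → ℝ) :
    pderiv i (fun Q => Q j) P = if i = j then 1 else 0 := by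
  have h : HasFDerivAt (fun Q : ι → ℝ => Q j) (ContinuousLinearMap.proj (R := ℝ) j) P :=
    (ContinuousLinearMap.proj (R := ℝ) (φ := fun _ : ι => ℝ) j).hasFDerivAt
  simp only [pderiv, h.fderiv, ContinuousLinearMap.proj_apply, Pi.single_apply, eq_comm]

theorem pderiv_add (i : ι) {f f' : (ι → ℝ) → ℝ} {P : ι → ℝ} (h : DifferentiableAt ℝ f P)
    (h' : DifferentiableAt ℝ f' P) :
    pderiv i (fun Q => f Q + f' Q) P = pderiv i f P + pderiv i f' P := by
  simp only [pderiv, fderiv_fun_add h h', add_apply]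

theorem pderiv_sub (i : ι) {f f' : (ι → ℝ) → ℝ} {P : ι → ℝ} (h : DifferentiableAt ℝ f P)
    (h' : DifferentiableAt ℝ f' P) :
    pderiv i (fun Q => f Q - f' Q) P = pderiv i f P - pderiv i f' P := by
  simp only [pderiv, fderiv_fun_sub h h', sub_apply]

theorem pderiv_mul (i : ι) {f f' : (ι → ℝ) → ℝ} {P : ι → ℝ} (h : DifferentiableAt ℝ f P)
    (h' : DifferentiableAt ℝ f' P) :
    pderiv i (fun Q => f Q * f' Q) P = pderiv i f P * f' P + f P * pderiv i f' P := by
  simp only [pderiv, fderiv_fun_mul h h', add_apply,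
    smul_apply, smul_eq_mul]
  ring

theorem pderiv_const_mul (i : ι) (c : ℝ) {f : (ι → ℝ) → ℝ} {P : ι → ℝ}
    (h : DifferentiableAt ℝ f P) : pderiv i (fun Q => c * f Q) P = c * pderiv i f P := by
  rw [pderiv_mul i (differentiableAt_const c) h, pderiv_const]; ring

theorem pderiv_sum (i : ι) {α : Type} (s : Finset α) {f : α → (ι → ℝ) → ℝ} {P : ι → ℝ}
    (h : ∀ a ∈ s, DifferentiableAt ℝ (f a) P) :
    pderiv i (fun Q => ∑ a ∈ s, f a Q) P = ∑ a ∈ s, pderiv i (f a) P := by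
  simp only [pderiv, fderiv_fun_sum h, sum_apply]

theorem pderiv_comp (i : ι) {f : (κ → ℝ) → ℝ} {F : (ι → ℝ) → κ → ℝ} {P : ι → ℝ}
    (hf : DifferentiableAt ℝ f (F P)) (hF : DifferentiableAt ℝ F P) :
    pderiv i (fun Q => f (F Q)) P
      = ∑ k, pderiv k f (F P) * pderiv i (fun Q => F Q k) P := by
  have h : fderiv ℝ (fun Q => f (F Q)) P = (fderiv ℝ f (F P)).comp (fderiv ℝ F P) :=
    fderiv_comp P hf hF
  rw [pderiv, h, ContinuousLinearMap.comp_apply, fderiv_apply_eq_sum]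
  refine Finset.sum_congr rfl fun k _ => ?_
  rw [mul_comm, pderiv, fderiv_pi (fun k => differentiableAt_pi.1 hF k)]
  rfl

theorem fderiv_apply_coord {F : (ι → ℝ) → κ → ℝ} {P : ι → ℝ} (hF : DifferentiableAt ℝ F P)
    (v : ι → ℝ) (k : κ) : fderiv ℝ F P v k = ∑ i, v i * pderiv i (fun Q => F Q k) P := by
  rw [← fderiv_apply_eq_sum, fderiv_pi (fun k => differentiableAt_pi.1 hF k)]
  rfl

theorem contDiffAt_pderiv {f : (ι → ℝ) → ℝ} {P : ι → ℝ} (h : ContDiffAt ℝ ∞ f P) (i : ι) :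
    ContDiffAt ℝ ∞ (fun Q => pderiv i f Q) P :=
  (h.fderiv_right (m := ∞) (by simp)).clm_apply contDiffAt_const

theorem differentiableAt_of_smooth {E : Type} [NormedAddCommGroup E] [NormedSpace ℝ E]
    {f : (ι → ℝ) → E} {P : ι → ℝ} (h : ContDiffAt ℝ ∞ f P) : DifferentiableAt ℝ f P :=
  h.differentiableAt (by simp)

theorem pderiv_comm {f : (ι → ℝ) → ℝ} {P : ι → ℝ} (h : ContDiffAt ℝ ∞ f P) (i j : ι) :
    pderiv i (fun Q => pderiv j f Q) P = pderiv j (fun Q => pderiv i f Q) P := by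
  have hs : IsSymmSndFDerivAt ℝ f P := h.isSymmSndFDerivAt (by simpa using WithTop.coe_le_coe.2 (le_top (a := (2 : ℕ∞))))
  have hd : DifferentiableAt ℝ (fderiv ℝ f) P :=
    (h.fderiv_right (m := ∞) (by simp)).differentiableAt (by simp)
  have key : ∀ a b : ι, pderiv a (fun Q => pderiv b f Q) P
      = fderiv ℝ (fderiv ℝ f) P (Pi.single a 1) (Pi.single b 1) := by
    intro a b
    simp only [pderiv]
    rw [fderiv_clm_apply hd (differentiableAt_const _)]
    simp
  rw [key, key, hs.eq]

theorem fderiv_eq_zero_of_pderiv {f : (ι → ℝ) → ℝ} {P : ι → ℝ} (h : ∀ i, pderiv i f P = 0) :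
    fderiv ℝ f P = 0 := by
  ext v
  rw [fderiv_apply_eq_sum]; simp [h]

/-- A function whose partial derivatives all vanish on a ball is constant there. -/
theorem eq_of_pderiv_eq_zero {f : (ι → ℝ) → ℝ} {P : ι → ℝ} {r : ℝ}
    (hf : DifferentiableOn ℝ f (Metric.ball P r))
    (h : ∀ Q ∈ Metric.ball P r, ∀ i, pderiv i f Q = 0) {Q Q' : ι → ℝ}
    (hQ : Q ∈ Metric.ball P r) (hQ' : Q' ∈ Metric.ball P r) : f Q = f Q' :=
  Metric.isOpen_ball.is_const_of_fderiv_eq_zero (convex_ball P r).isPreconnected hf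
    (fun R hR => fderiv_eq_zero_of_pderiv (h R hR)) hQ hQ'

end Calculus

/-! ### Transformation of metric and Christoffel symbols under local isometries. -/

section Isometry

variable {ι : Type} [Fintype ι] [DecidableEq ι]

/-- The Christoffel symbols with all indices lowered. -/
def christoffelLower (g : (ι → ℝ) → Matrix ι ι ℝ) (P : ι → ℝ) (i j l : ι) : ℝ :=
  (1 / 2) * (pderiv i (fun Q => g Q j l) P + pderiv j (fun Q => g Q i l) P
    - pderiv l (fun Q => g Q i j) P)

theorem sum_mul_christoffel {g : (ι → ℝ) → Matrix ι ι ℝ} {P : ι → ℝ} (h : IsUnit (g P).det)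
    (c i j : ι) : ∑ k, g P c k * christoffel g P k i j = christoffelLower g P i j c := by
  have h1 : (g P) *ᵥ ((g P)⁻¹ *ᵥ fun l => christoffelLower g P i j l)
      = fun l => christoffelLower g P i j l := by
    rw [Matrix.mulVec_mulVec, Matrix.mul_nonsing_inv _ h, Matrix.one_mulVec]
  have h2 := congrFun h1 c
  simp only [Matrix.mulVec, dotProduct] at h2
  rw [← h2]
  refine Finset.sum_congr rfl fun k _ => ?_
  simp only [christoffel, christoffelLower, Finset.mul_sum]
  exact Finset.sum_congr rfl fun l _ => by ring

theorem formOf_eq_sum (G : Matrix ι ι ℝ) (v w : ι → ℝ) :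
    formOf G v w = ∑ l, ∑ m, G l m * v l * w m := by
  simp only [formOf, Matrix.mulVec, dotProduct, Finset.mul_sum]
  exact Finset.sum_congr rfl fun l _ => Finset.sum_congr rfl fun m _ => by ring

theorem formOf_single (G : Matrix ι ι ℝ) (a b : ι) :
    formOf G (Pi.single a 1) (Pi.single b 1) = G a b := by
  simp [formOf]

variable {g g' : (ι → ℝ) → Matrix ι ι ℝ} {F : (ι → ℝ) → (ι → ℝ)} {U : Set (ι → ℝ)}

theorem IsLocalIsometryOn.contDiffAt (hF : IsLocalIsometryOn g g' F U) {P : ι → ℝ} (hP : P ∈ U) :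
    ContDiffAt ℝ ∞ F P :=
  hF.smooth.contDiffAt (hF.isOpen.mem_nhds hP)

theorem IsLocalIsometryOn.contDiffAt_coord (hF : IsLocalIsometryOn g g' F U) {P : ι → ℝ}
    (hP : P ∈ U) (k : ι) : ContDiffAt ℝ ∞ (fun Q => F Q k) P :=
  contDiffAt_pi.1 (hF.contDiffAt hP) k

theorem IsLocalIsometryOn.metric_eq (hF : IsLocalIsometryOn g g' F U) {P : ι → ℝ} (hP : P ∈ U)
    (a b : ι) : g P a b = ∑ l, ∑ m, g' (F P) l m * pderiv a (fun Q => F Q l) P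
      * pderiv b (fun Q => F Q m) P := by
  have hd := differentiableAt_of_smooth (hF.contDiffAt hP)
  rw [← formOf_single (g P), ← hF.pullback P hP, formOf_eq_sum]
  simp only [fderiv_apply_coord hd]
  simp [Pi.single_apply]

/-- Product and chain rule applied to `metric_eq`, which holds on a whole neighbourhood of `P`. -/
theorem IsLocalIsometryOn.pderiv_metric (hF : IsLocalIsometryOn g g' F U)
    (hg' : ∀ P l m, DifferentiableAt ℝ (fun Q => g' Q l m) P) {P : ι → ℝ} (hP : P ∈ U)
    (c a b : ι) : pderiv c (fun Q => g Q a b) P =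
      ∑ n, ∑ l, ∑ m, pderiv n (fun Q => g' Q l m) (F P) * pderiv c (fun Q => F Q n) P
        * pderiv a (fun Q => F Q l) P * pderiv b (fun Q => F Q m) P
      + (∑ l, ∑ m, g' (F P) l m * pderiv c (fun Q => pderiv a (fun Q => F Q l) Q) P
          * pderiv b (fun Q => F Q m) P
        + ∑ l, ∑ m, g' (F P) l m * pderiv a (fun Q => F Q l) P
          * pderiv c (fun Q => pderiv b (fun Q => F Q m) Q) P) := by
  have hd := differentiableAt_of_smooth (hF.contDiffAt hP)
  have hJ : ∀ a l, DifferentiableAt ℝ (fun Q => pderiv a (fun Q => F Q l) Q) P := fun a l =>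
    differentiableAt_of_smooth (contDiffAt_pderiv (hF.contDiffAt_coord hP l) a)
  have hG : ∀ l m, DifferentiableAt ℝ (fun Q => g' (F Q) l m) P := fun l m =>
    DifferentiableAt.comp P (hg' (F P) l m) hd
  have h1 : (fun Q => g Q a b) =ᶠ[nhds P] fun Q => ∑ l, ∑ m, g' (F Q) l m
      * pderiv a (fun Q => F Q l) Q * pderiv b (fun Q => F Q m) Q := by
    filter_upwards [hF.isOpen.mem_nhds hP] with Q hQ
    exact hF.metric_eq hQ a b
  have h2 : ∀ l m, pderiv c (fun Q => g' (F Q) l m * pderiv a (fun Q => F Q l) Q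
        * pderiv b (fun Q => F Q m) Q) P =
      ∑ n, pderiv n (fun Q => g' Q l m) (F P) * pderiv c (fun Q => F Q n) P
        * pderiv a (fun Q => F Q l) P * pderiv b (fun Q => F Q m) P
      + (g' (F P) l m * pderiv c (fun Q => pderiv a (fun Q => F Q l) Q) P
          * pderiv b (fun Q => F Q m) P
        + g' (F P) l m * pderiv a (fun Q => F Q l) P
          * pderiv c (fun Q => pderiv b (fun Q => F Q m) Q) P) := by
    intro l m
    have e := pderiv_comp c (f := fun Q => g' Q l m) (hg' _ l m) hd
    have e1 := pderiv_mul c (hG l m) (hJ a l)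
    have e2 := pderiv_mul c ((hG l m).fun_mul (hJ a l)) (hJ b m)
    rw [e2, e1, e]
    simp only [Finset.sum_mul, add_mul]
    ring
  rw [pderiv_congr h1, pderiv_sum _ _ fun l _ => DifferentiableAt.fun_sum fun m _ =>
    ((hG l m).fun_mul (hJ a l)).fun_mul (hJ b m)]
  simp only [pderiv_sum c Finset.univ
    fun m _ => ((hG _ m).fun_mul (hJ a _)).fun_mul (hJ b m), h2]
  simp only [Finset.sum_add_distrib]
  congr 1
  exact Finset.sum_comm_cycle

theorem IsLocalIsometryOn.isUnit_jacobian (hF : IsLocalIsometryOn g g' F U)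
    {P : ι → ℝ} (hP : P ∈ U) (hgP : IsUnit (g P).det) :
    IsUnit (Matrix.of fun a l => pderiv a (fun Q => F Q l) P).det := by
  have h : g P = (Matrix.of fun a l => pderiv a (fun Q => F Q l) P) * g' (F P)
      * (Matrix.of fun a l => pderiv a (fun Q => F Q l) P)ᵀ := by
    ext a b
    rw [hF.metric_eq hP]
    simp only [Matrix.mul_apply, Matrix.of_apply, Matrix.transpose_apply, Finset.sum_mul]
    rw [Finset.sum_comm]
    exact Finset.sum_congr rfl fun l _ => Finset.sum_congr rfl fun m _ => by ring
  rw [h, Matrix.det_mul, Matrix.det_mul] at hgP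
  exact isUnit_of_mul_isUnit_left (isUnit_of_mul_isUnit_left hgP)

/-- In the Koszul combination of three instances of `pderiv_metric`, symmetry of second derivatives
and of `g'` cancels every second derivative of `F` except `∂_a ∂_b F`. -/
theorem IsLocalIsometryOn.christoffelLower_eq (hF : IsLocalIsometryOn g g' F U)
    (hg' : ∀ P l m, DifferentiableAt ℝ (fun Q => g' Q l m) P) (hs : ∀ P l m, g' P l m = g' P m l)
    {P : ι → ℝ} (hP : P ∈ U) (a b c : ι) : christoffelLower g P a b c =
      (∑ n, ∑ l, ∑ m, christoffelLower g' (F P) n l m * pderiv a (fun Q => F Q n) P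
        * pderiv b (fun Q => F Q l) P * pderiv c (fun Q => F Q m) P)
      + ∑ l, ∑ m, g' (F P) l m * pderiv a (fun Q => pderiv b (fun Q => F Q l) Q) P
          * pderiv c (fun Q => F Q m) P := by
  have hsym : ∀ x y l, pderiv x (fun Q => pderiv y (fun Q => F Q l) Q) P
      = pderiv y (fun Q => pderiv x (fun Q => F Q l) Q) P := fun x y l =>
    pderiv_comm (hF.contDiffAt_coord hP l) x y
  have hlm : ∀ p q : ι → ℝ, ∑ l, ∑ m, g' (F P) l m * p l * q m
      = ∑ l, ∑ m, g' (F P) l m * q l * p m := by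
    intro p q
    rw [Finset.sum_comm]
    refine Finset.sum_congr rfl fun l _ => Finset.sum_congr rfl fun m _ => ?_
    rw [hs]; ring
  have hlow : ∀ p q r : ι → ℝ, ∑ n, ∑ l, ∑ m, christoffelLower g' (F P) n l m * p n * q l * r m
      = (1 / 2) * (∑ n, ∑ l, ∑ m, pderiv n (fun Q => g' Q l m) (F P) * p n * q l * r m
        + ∑ n, ∑ l, ∑ m, pderiv n (fun Q => g' Q l m) (F P) * q n * p l * r m
        - ∑ n, ∑ l, ∑ m, pderiv n (fun Q => g' Q l m) (F P) * r n * p l * q m) := by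
    intro p q r
    have h1 : ∑ n, ∑ l, ∑ m, pderiv n (fun Q => g' Q l m) (F P) * q n * p l * r m
        = ∑ n, ∑ l, ∑ m, pderiv l (fun Q => g' Q n m) (F P) * q l * p n * r m := Finset.sum_comm
    have h2 : ∑ n, ∑ l, ∑ m, pderiv n (fun Q => g' Q l m) (F P) * r n * p l * q m
        = ∑ n, ∑ l, ∑ m, pderiv m (fun Q => g' Q n l) (F P) * r m * p n * q l := by
      rw [Finset.sum_comm]
      exact Finset.sum_congr rfl fun l _ => Finset.sum_comm
    rw [h1, h2]
    simp only [Finset.mul_sum, ← Finset.sum_add_distrib, ← Finset.sum_sub_distrib,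
      christoffelLower]
    exact Finset.sum_congr rfl fun n _ => Finset.sum_congr rfl fun l _ =>
      Finset.sum_congr rfl fun m _ => by ring
  rw [hlow]
  unfold christoffelLower
  rw [hF.pderiv_metric hg' hP a b c, hF.pderiv_metric hg' hP b a c, hF.pderiv_metric hg' hP c a b]
  simp only [hsym b a, hsym c a, hsym c b]
  rw [hlm (fun l => pderiv b (fun Q => F Q l) P)
      (fun m => pderiv a (fun Q => pderiv c (fun Q => F Q m) Q) P)]
  ring

/-- The second derivatives of a local isometry in terms of its first derivatives. -/
theorem IsLocalIsometryOn.pderiv_pderiv (hF : IsLocalIsometryOn g g' F U)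
    (hg : ∀ P, IsUnit (g P).det) (hg1 : ∀ P, IsUnit (g' P).det)
    (hg' : ∀ P l m, DifferentiableAt ℝ (fun Q => g' Q l m) P) (hs : ∀ P l m, g' P l m = g' P m l)
    {P : ι → ℝ} (hP : P ∈ U) (a b k : ι) :
    pderiv a (fun Q => pderiv b (fun Q => F Q k) Q) P =
      ∑ d, christoffel g P d a b * pderiv d (fun Q => F Q k) P
      - ∑ n, ∑ l, christoffel g' (F P) k n l * pderiv a (fun Q => F Q n) P
        * pderiv b (fun Q => F Q l) P := by
  set J : Matrix ι ι ℝ := Matrix.of fun a l => pderiv a (fun Q => F Q l) P with hJ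
  -- `Z` is the defect in the claimed formula. The lowered law says that `J g' Z = 0`, and both `J`
  -- and `g'` are invertible.
  set Z : ι → ℝ := fun k => pderiv a (fun Q => pderiv b (fun Q => F Q k) Q) P
    + ∑ n, ∑ l, christoffel g' (F P) k n l * pderiv a (fun Q => F Q n) P
        * pderiv b (fun Q => F Q l) P
    - ∑ d, christoffel g P d a b * pderiv d (fun Q => F Q k) P with hZ
  have hJu : IsUnit J.det := hF.isUnit_jacobian hP (hg P)
  have h1 : ∀ c, ∑ m, ∑ l, g' (F P) m l * Z l * pderiv c (fun Q => F Q m) P = 0 := by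
    intro c
    have e1 := hF.christoffelLower_eq hg' hs hP a b c
    have e2 : ∑ m, ∑ l, g' (F P) m l * (∑ d, christoffel g P d a b * pderiv d (fun Q => F Q l) P)
        * pderiv c (fun Q => F Q m) P = christoffelLower g P a b c := by
      rw [← sum_mul_christoffel (hg P)]
      simp only [hF.metric_eq hP, Finset.sum_mul, Finset.mul_sum]
      rw [Finset.sum_comm_cycle]
      exact Finset.sum_congr rfl fun m _ => Finset.sum_congr rfl fun l _ =>
        Finset.sum_congr rfl fun n _ => by ring
    have e3 : ∑ m, ∑ l, g' (F P) m l * (∑ n, ∑ k, christoffel g' (F P) l n k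
          * pderiv a (fun Q => F Q n) P * pderiv b (fun Q => F Q k) P)
        * pderiv c (fun Q => F Q m) P = ∑ n, ∑ l, ∑ m, christoffelLower g' (F P) n l m
        * pderiv a (fun Q => F Q n) P * pderiv b (fun Q => F Q l) P
        * pderiv c (fun Q => F Q m) P := by
      simp only [← sum_mul_christoffel (hg1 (F P)), Finset.sum_mul, Finset.mul_sum]
      rw [Finset.sum_comm_cycle]
      refine Finset.sum_congr rfl fun n _ => ?_
      rw [Finset.sum_comm_cycle]
      exact Finset.sum_congr rfl fun k _ => Finset.sum_congr rfl fun m _ =>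
        Finset.sum_congr rfl fun l _ => by ring
    have e4 : ∑ m, ∑ l, g' (F P) m l * pderiv a (fun Q => pderiv b (fun Q => F Q l) Q) P
        * pderiv c (fun Q => F Q m) P = ∑ l, ∑ m, g' (F P) l m
        * pderiv a (fun Q => pderiv b (fun Q => F Q l) Q) P * pderiv c (fun Q => F Q m) P := by
      rw [Finset.sum_comm]
      exact Finset.sum_congr rfl fun m _ => Finset.sum_congr rfl fun l _ => by rw [hs]
    simp only [hZ, mul_add, mul_sub, add_mul, sub_mul, Finset.sum_add_distrib,
      Finset.sum_sub_distrib, e2, e3, e4]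
    linarith
  have h2 : J *ᵥ (g' (F P) *ᵥ Z) = 0 := by
    ext c
    rw [Pi.zero_apply, ← h1 c]
    simp only [Matrix.mulVec, dotProduct, hJ, Matrix.of_apply, Finset.mul_sum]
    exact Finset.sum_congr rfl fun m _ => Finset.sum_congr rfl fun l _ => by ring
  have h3 : Z = 0 := by
    have i1 := Matrix.mulVec_injective_of_isUnit ((Matrix.isUnit_iff_isUnit_det _).2 hJu)
    have i2 := Matrix.mulVec_injective_of_isUnit ((Matrix.isUnit_iff_isUnit_det _).2 (hg1 (F P)))
    exact i2 ((i1 (h2.trans (Matrix.mulVec_zero J).symm)).trans (Matrix.mulVec_zero _).symm)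
  have h4 := congrFun h3 k
  simp only [hZ, Pi.zero_apply] at h4
  linarith

end Isometry

open Coord

/-! ### Metrics whose `x`-block is linear in the fibre coordinates. -/

section BlockMetric

theorem sum_coord (f : Coord → ℝ) : ∑ c, f c
    = ∑ i, f (x i) + ∑ i, f (xs i) + ∑ b : Fin 4 × Fin 2, f (y b.1 b.2) := by
  let e : (Fin 3 ⊕ Fin 3) ⊕ (Fin 4 × Fin 2) ≃ Coord :=
    { toFun := Sum.elim (Sum.elim x xs) fun b => y b.1 b.2
      invFun := fun c => match c with
        | x i => Sum.inl (Sum.inl i)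
        | xs i => Sum.inl (Sum.inr i)
        | y i j => Sum.inr (i, j)
      left_inv := by rintro ((i | i) | ⟨i, j⟩) <;> rfl
      right_inv := by rintro (i | i | ⟨i, j⟩) <;> rfl }
  rw [← e.sum_comp, Fintype.sum_sum_type, Fintype.sum_sum_type]
  rfl

/-- The constant inner product on the span of the `y`-directions. -/
def fiberForm (b b' : Fin 4 × Fin 2) : ℝ := metricWithBlock 0 (y b.1 b.2) (y b'.1 b'.2)

/-- The inverse of `fiberForm`. -/
def fiberInv (b b' : Fin 4 × Fin 2) : ℝ :=
  if b.1 = b'.1 then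
    if b.1 = 3 then (if b.2 = b'.2 then -8 / 3 else -4 / 3) else (if b.2 = b'.2 then 0 else 1)
  else 0

theorem fiberForm_comm (b b' : Fin 4 × Fin 2) : fiberForm b b' = fiberForm b' b := by
  simp only [fiberForm, metricWithBlock, eq_comm (a := b.1), eq_comm (a := b.2)]
  split_ifs <;> simp_all

theorem fiberInv_comm (b b' : Fin 4 × Fin 2) : fiberInv b b' = fiberInv b' b := by
  simp only [fiberInv, eq_comm (a := b.1), eq_comm (a := b.2)]
  split_ifs <;> simp_all

/-- The exceptional block has diagonal `-1/2`, off-diagonal `1/4` and determinant `3/16`, whence the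
entries `-8/3` and `-4/3` of the inverse. -/
theorem sum_fiberForm_mul_fiberInv (b b' : Fin 4 × Fin 2) :
    ∑ d, fiberForm b d * fiberInv d b' = if b = b' then 1 else 0 := by
  obtain ⟨i, j⟩ := b
  obtain ⟨k, l⟩ := b'
  simp only [Fintype.sum_prod_type, Fin.sum_univ_four, Fin.sum_univ_two, fiberForm,
    metricWithBlock, fiberInv]
  fin_cases i <;> fin_cases j <;> fin_cases k <;> fin_cases l <;> simp +decide <;> norm_num

/-- The inverse of `metricWithBlock S`. -/
def invWithBlock (S : Matrix (Fin 3) (Fin 3) ℝ) : Matrix Coord Coord ℝ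
  | x i, xs j => if i = j then 1 else 0
  | xs i, x j => if i = j then 1 else 0
  | xs i, xs j => -S i j
  | y i j, y i' j' => fiberInv (i, j) (i', j')
  | _, _ => 0

theorem metricWithBlock_mul_invWithBlock (S : Matrix (Fin 3) (Fin 3) ℝ) :
    metricWithBlock S * invWithBlock S = 1 := by
  ext a b
  rw [Matrix.mul_apply, sum_coord]
  cases a <;> cases b <;>
    simp [metricWithBlock, invWithBlock, Matrix.one_apply]
  case y.y i j k l =>
    simpa [fiberForm, metricWithBlock] using sum_fiberForm_mul_fiberInv (i, j) (k, l)

theorem isUnit_det_metricWithBlock (S : Matrix (Fin 3) (Fin 3) ℝ) :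
    IsUnit (metricWithBlock S).det :=
  IsUnit.of_mul_eq_one _ (by
    rw [← Matrix.det_mul, metricWithBlock_mul_invWithBlock, Matrix.det_one])

theorem inv_metricWithBlock (S : Matrix (Fin 3) (Fin 3) ℝ) :
    (metricWithBlock S)⁻¹ = invWithBlock S :=
  Matrix.inv_eq_right_inv (metricWithBlock_mul_invWithBlock S)

theorem formOf_metricWithBlock (S : Matrix (Fin 3) (Fin 3) ℝ) (v w : Coord → ℝ) :
    formOf (metricWithBlock S) v w = ∑ i, ∑ j, S i j * v (x i) * w (x j)
      + ∑ i, (v (x i) * w (xs i) + v (xs i) * w (x i))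
      + ∑ b : Fin 4 × Fin 2, ∑ b' : Fin 4 × Fin 2,
          fiberForm b b' * v (y b.1 b.2) * w (y b'.1 b'.2) := by
  simp only [formOf_eq_sum, sum_coord]
  simp [metricWithBlock, fiberForm, Finset.sum_add_distrib]
  ring

/-- The projection to the `x`-coordinates. -/
def base (P : Coord → ℝ) (i : Fin 3) : ℝ := P (x i)

/-- The function `∑ t_b(x) y_b`. -/
def fiberLinear (t : Fin 4 × Fin 2 → (Fin 3 → ℝ) → ℝ) (P : Coord → ℝ) : ℝ :=
  ∑ b, t b (base P) * P (y b.1 b.2)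

theorem contDiff_base : ContDiff ℝ ∞ base :=
  contDiff_pi.2 fun i => contDiff_apply ℝ ℝ (x i)

theorem contDiff_fiberLinear {t : Fin 4 × Fin 2 → (Fin 3 → ℝ) → ℝ}
    (ht : ∀ b, ContDiff ℝ ∞ (t b)) : ContDiff ℝ ∞ (fiberLinear t) :=
  ContDiff.sum fun b _ => ((ht b).comp contDiff_base).mul (contDiff_apply ℝ ℝ (y b.1 b.2))

theorem contDiff_pderiv {ι : Type} [Fintype ι] [DecidableEq ι] {f : (ι → ℝ) → ℝ}
    (h : ContDiff ℝ ∞ f) (i : ι) : ContDiff ℝ ∞ (pderiv i f) :=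
  contDiff_iff_contDiffAt.2 fun _ => contDiffAt_pderiv h.contDiffAt i

theorem smooth_differentiableAt {E : Type} [NormedAddCommGroup E] [NormedSpace ℝ E]
    {F : Type} [NormedAddCommGroup F] [NormedSpace ℝ F]
    {f : E → F} (h : ContDiff ℝ ∞ f) (P : E) : DifferentiableAt ℝ f P :=
  (h.differentiable (by simp)) P

section

variable {t : (Fin 3 → ℝ) → ℝ} (ht : ContDiff ℝ ∞ t) (P : Coord → ℝ)
include ht

theorem pderiv_comp_base (c : Coord) : pderiv c (fun Q => t (base Q)) P
    = ∑ k, pderiv k t (base P) * (if c = x k then 1 else 0) := by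
  rw [pderiv_comp c (smooth_differentiableAt ht _) (smooth_differentiableAt contDiff_base _)]
  simp only [base, pderiv_coord]

theorem pderiv_x_comp_base (k : Fin 3) :
    pderiv (x k) (fun Q => t (base Q)) P = pderiv k t (base P) := by
  simp [pderiv_comp_base ht]

theorem pderiv_xs_comp_base (k : Fin 3) : pderiv (xs k) (fun Q => t (base Q)) P = 0 := by
  simp [pderiv_comp_base ht]

theorem pderiv_y_comp_base (i : Fin 4) (j : Fin 2) :
    pderiv (y i j) (fun Q => t (base Q)) P = 0 := by
  simp [pderiv_comp_base ht]

end

section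

variable {t : Fin 4 × Fin 2 → (Fin 3 → ℝ) → ℝ} (ht : ∀ b, ContDiff ℝ ∞ (t b)) (P : Coord → ℝ)
include ht

theorem pderiv_fiberLinear (c : Coord) : pderiv c (fiberLinear t) P
    = ∑ b, (pderiv c (fun Q => t b (base Q)) P * P (y b.1 b.2)
      + t b (base P) * (if c = y b.1 b.2 then 1 else 0)) := by
  have h1 : ∀ b, DifferentiableAt ℝ (fun Q : Coord → ℝ => t b (base Q)) P := fun b =>
    smooth_differentiableAt ((ht b).comp contDiff_base) P
  have h2 : ∀ b : Fin 4 × Fin 2, DifferentiableAt ℝ (fun Q : Coord → ℝ => Q (y b.1 b.2)) P :=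
    fun b => differentiableAt_apply _ _
  unfold fiberLinear
  rw [pderiv_sum c _ fun b _ => (h1 b).fun_mul (h2 b)]
  exact Finset.sum_congr rfl fun b _ => by rw [pderiv_mul c (h1 b) (h2 b), pderiv_coord]

theorem pderiv_x_fiberLinear (k : Fin 3) : pderiv (x k) (fiberLinear t) P
    = fiberLinear (fun b => pderiv k (t b)) P := by
  simp [pderiv_fiberLinear ht, pderiv_x_comp_base (ht _), fiberLinear]

theorem pderiv_xs_fiberLinear (k : Fin 3) : pderiv (xs k) (fiberLinear t) P = 0 := by
  simp [pderiv_fiberLinear ht, pderiv_xs_comp_base (ht _)]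

theorem pderiv_y_fiberLinear (i : Fin 4) (j : Fin 2) :
    pderiv (y i j) (fiberLinear t) P = t (i, j) (base P) := by
  simp only [pderiv_fiberLinear ht, pderiv_y_comp_base (ht _), zero_mul, zero_add]
  rw [Finset.sum_eq_single (i, j)]
  · simp
  · rintro ⟨k, l⟩ _ h
    rw [if_neg, mul_zero]
    rintro h'
    injection h' with h1 h2
    exact h (by rw [h1, h2])
  · simp

end

/-- The metric with `x`-block `∑ T_{ij,b}(x) y_b`. -/
def linearMetric (T : Fin 3 → Fin 3 → Fin 4 × Fin 2 → (Fin 3 → ℝ) → ℝ) (P : Coord → ℝ) :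
    Matrix Coord Coord ℝ :=
  metricWithBlock (Matrix.of fun i j => fiberLinear (T i j) P)

/-- A smooth family of symmetric bilinear forms. -/
structure IsSmoothSymm (T : Fin 3 → Fin 3 → Fin 4 × Fin 2 → (Fin 3 → ℝ) → ℝ) : Prop where
  symm : ∀ i j, T i j = T j i
  smooth : ∀ i j b, ContDiff ℝ ∞ (T i j b)

/-- The Christoffel symbols of `linearMetric T`. -/
def linearChristoffel (T : Fin 3 → Fin 3 → Fin 4 × Fin 2 → (Fin 3 → ℝ) → ℝ) (P : Coord → ℝ) :
    Coord → Coord → Coord → ℝ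
  | xs k, x i, x j => (1 / 2) * (fiberLinear (fun b => pderiv i (T j k b)) P
      + fiberLinear (fun b => pderiv j (T i k b)) P - fiberLinear (fun b => pderiv k (T i j b)) P)
  | xs k, x i, y p q => (1 / 2) * T i k (p, q) (base P)
  | xs k, y p q, x i => (1 / 2) * T i k (p, q) (base P)
  | y p q, x i, x j => -(1 / 2) * ∑ b, fiberInv (p, q) b * T i j b (base P)
  | _, _, _ => 0

variable {T : Fin 3 → Fin 3 → Fin 4 × Fin 2 → (Fin 3 → ℝ) → ℝ} (hT : IsSmoothSymm T)
include hT

omit hT in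
theorem pderiv_linearMetric_x_x (P : Coord → ℝ) (c : Coord) (i j : Fin 3) :
    pderiv c (fun Q => linearMetric T Q (x i) (x j)) P = pderiv c (fiberLinear (T i j)) P :=
  rfl

omit hT in
theorem pderiv_linearMetric_of_const (P : Coord → ℝ) (c a b : Coord)
    (h : ∀ Q Q', linearMetric T Q a b = linearMetric T Q' a b) :
    pderiv c (fun Q => linearMetric T Q a b) P = 0 := by
  rw [show (fun Q => linearMetric T Q a b) = fun _ => linearMetric T 0 a b from
    funext fun Q => h Q 0, pderiv_const]

/-- Only the `x`-block of the metric varies, and the inverse metric has neither `x x`- nor `x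
y`-entries. Hence no symbol has an upper `x`-index or a lower `x^*`-index, which is what makes the
family tractable. -/
theorem christoffel_linearMetric (P : Coord → ℝ) (k i j : Coord) :
    christoffel (linearMetric T) P k i j = linearChristoffel T P k i j := by
  have e1 := pderiv_linearMetric_x_x (T := T) P
  have e2 : ∀ c i j, pderiv c (fun Q => linearMetric T Q (x i) (xs j)) P = 0 := fun c i j =>
    pderiv_linearMetric_of_const P c _ _ fun _ _ => rfl
  have e3 : ∀ c i j, pderiv c (fun Q => linearMetric T Q (xs i) (x j)) P = 0 := fun c i j =>
    pderiv_linearMetric_of_const P c _ _ fun _ _ => rfl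
  have e4 : ∀ c i p q, pderiv c (fun Q => linearMetric T Q (x i) (y p q)) P = 0 :=
    fun c i p q => pderiv_linearMetric_of_const P c _ _ fun _ _ => rfl
  have e5 : ∀ c i p q, pderiv c (fun Q => linearMetric T Q (y p q) (x i)) P = 0 :=
    fun c i p q => pderiv_linearMetric_of_const P c _ _ fun _ _ => rfl
  have e6 : ∀ c i j, pderiv c (fun Q => linearMetric T Q (xs i) (xs j)) P = 0 := fun c i j =>
    pderiv_linearMetric_of_const P c _ _ fun _ _ => rfl
  have e7 : ∀ c i p q, pderiv c (fun Q => linearMetric T Q (xs i) (y p q)) P = 0 :=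
    fun c i p q => pderiv_linearMetric_of_const P c _ _ fun _ _ => rfl
  have e8 : ∀ c i p q, pderiv c (fun Q => linearMetric T Q (y p q) (xs i)) P = 0 :=
    fun c i p q => pderiv_linearMetric_of_const P c _ _ fun _ _ => rfl
  have e9 : ∀ c p q p' q', pderiv c (fun Q => linearMetric T Q (y p q) (y p' q')) P = 0 :=
    fun c p q p' q' => pderiv_linearMetric_of_const P c _ _ fun _ _ => rfl
  have hs := hT.smooth
  rw [christoffel, show (linearMetric T P)⁻¹ = invWithBlock _ from inv_metricWithBlock _,
    sum_coord]
  cases k <;> cases i <;> cases j <;>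
    simp [invWithBlock, linearChristoffel, e1, e2, e3, e4, e5, e6, e7, e8, e9,
      pderiv_x_fiberLinear (hs _ _), pderiv_xs_fiberLinear (hs _ _), pderiv_y_fiberLinear (hs _ _)]

theorem contDiff_linearMetric (a b : Coord) : ContDiff ℝ ∞ fun Q => linearMetric T Q a b := by
  have h := fun i j => contDiff_fiberLinear (hT.smooth i j)
  cases a <;> cases b <;> simp only [linearMetric, metricWithBlock, Matrix.of_apply] <;>
    first | exact h _ _ | exact contDiff_const

theorem linearMetric_comm (P : Coord → ℝ) (a b : Coord) :
    linearMetric T P a b = linearMetric T P b a := by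
  have h := hT.symm
  cases a <;> cases b <;> simp only [linearMetric, metricWithBlock, Matrix.of_apply]
  case x.x i j => rw [h]
  case x.xs i j => simp only [eq_comm]
  case xs.x i j => simp only [eq_comm]
  case y.y i j k l => exact fiberForm_comm (i, j) (k, l)

end BlockMetric

/-! ### Curvature of the linear family. -/

section LinearCurvature

/-- The components `R(x_i, x_j, x_k, y_b)` of the curvature of `linearMetric T`. -/
def mixedCurv (T : Fin 3 → Fin 3 → Fin 4 × Fin 2 → (Fin 3 → ℝ) → ℝ) (i j k : Fin 3)
    (b : Fin 4 × Fin 2) (p : Fin 3 → ℝ) : ℝ :=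
  -(1 / 2) * (pderiv i (T j k b) p - pderiv j (T i k b) p)

/-- The components `R(x_i, x_j, x_k, x_l)` of the curvature of `linearMetric T`. -/
def baseCurv (T : Fin 3 → Fin 3 → Fin 4 × Fin 2 → (Fin 3 → ℝ) → ℝ) (P : Coord → ℝ)
    (i j k l : Fin 3) : ℝ :=
  (1 / 2) * (fiberLinear (fun b => pderiv i (pderiv k (T j l b))) P
      - fiberLinear (fun b => pderiv i (pderiv l (T j k b))) P
      - fiberLinear (fun b => pderiv j (pderiv k (T i l b))) P
      + fiberLinear (fun b => pderiv j (pderiv l (T i k b))) P)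
    - (1 / 4) * ∑ b, ∑ b', fiberInv b b' * (T j k b (base P) * T i l b' (base P)
        - T i k b (base P) * T j l b' (base P))

/-- The components of the curvature operator of `linearMetric T`. -/
def linearCurvatureOp (T : Fin 3 → Fin 3 → Fin 4 × Fin 2 → (Fin 3 → ℝ) → ℝ) (P : Coord → ℝ) :
    Coord → Coord → Coord → Coord → ℝ
  | x i, x j, x k, xs l => baseCurv T P i j k l
  | x i, x j, x k, y p q => ∑ b, fiberInv (p, q) b * mixedCurv T i j k b (base P)
  | x i, x j, y p q, xs l => -mixedCurv T i j l (p, q) (base P)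
  | x i, y p q, x k, xs l => mixedCurv T k l i (p, q) (base P)
  | y p q, x j, x k, xs l => -mixedCurv T k l j (p, q) (base P)
  | _, _, _, _ => 0

variable {T : Fin 3 → Fin 3 → Fin 4 × Fin 2 → (Fin 3 → ℝ) → ℝ} (hT : IsSmoothSymm T)
include hT

omit hT in
theorem baseCurv_antisymm (P : Coord → ℝ) (i j k l : Fin 3) :
    baseCurv T P i j l k = -baseCurv T P i j k l := by
  have h : ∀ f f' f'' f''' : Fin 4 × Fin 2 → ℝ,
      ∑ b, ∑ b', fiberInv b b' * (f b * f' b' - f'' b * f''' b')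
        = -∑ b, ∑ b', fiberInv b b' * (f''' b * f'' b' - f' b * f b') := by
    intro f f' f'' f'''
    simp only [mul_sub, Finset.sum_sub_distrib]
    rw [Finset.sum_comm (f := fun b b' => fiberInv b b' * (f''' b * f'' b')),
      Finset.sum_comm (f := fun b b' => fiberInv b b' * (f' b * f b'))]
    have e : ∀ f f' : Fin 4 × Fin 2 → ℝ, ∑ b, ∑ b', fiberInv b' b * (f b' * f' b)
        = ∑ b, ∑ b', fiberInv b b' * (f' b * f b') := fun f f' =>
      Finset.sum_congr rfl fun b _ => Finset.sum_congr rfl fun b' _ => by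
        rw [fiberInv_comm]; ring
    rw [e, e]; ring
  simp only [baseCurv]
  rw [h]
  ring

theorem pderiv_pderiv_comm (i j k l : Fin 3) (b : Fin 4 × Fin 2) :
    pderiv k (pderiv l (T i j b)) = pderiv l (pderiv k (T i j b)) :=
  funext fun _ => pderiv_comm (hT.smooth i j b).contDiffAt k l

theorem baseCurv_pair_symm (P : Coord → ℝ) (i j k l : Fin 3) :
    baseCurv T P k l i j = baseCurv T P i j k l := by
  have h : ∀ f f' : Fin 4 × Fin 2 → ℝ,
      ∑ b, ∑ b', fiberInv b b' * (f b * f' b') = ∑ b, ∑ b', fiberInv b b' * (f' b * f b') := by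
    intro f f'
    rw [Finset.sum_comm]
    exact Finset.sum_congr rfl fun b _ => Finset.sum_congr rfl fun b' _ => by
      rw [fiberInv_comm]; ring
  simp only [baseCurv, pderiv_pderiv_comm hT _ _ k, pderiv_pderiv_comm hT _ _ l, hT.symm l j,
    hT.symm l i, hT.symm k j, hT.symm k i, mul_sub, Finset.sum_sub_distrib]
  rw [h (fun b => T i l b (base P))]
  ring

/-- The only nonzero products of two Christoffel symbols contract `Γ^y_{xx}` with `Γ^{x^*}_{xy}`;
they yield the quadratic term of `baseCurv`. All other terms are derivatives of single symbols. -/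
theorem curvatureOp_linearMetric (P : Coord → ℝ) (i j k l : Coord) :
    curvatureOp (linearMetric T) P i j k l = linearCurvatureOp T P i j k l := by
  have hs := hT.smooth
  have hd : ∀ i j k b, ContDiff ℝ ∞ (pderiv i (T j k b)) := fun i j k b =>
    contDiff_pderiv (hs j k b) i
  have hl : ∀ i j k P, DifferentiableAt ℝ (fiberLinear fun b => pderiv i (T j k b)) P :=
    fun i j k P => smooth_differentiableAt (contDiff_fiberLinear (hd i j k)) P
  have hb : ∀ j k b P, DifferentiableAt ℝ (fun Q : Coord → ℝ => T j k b (base Q)) P :=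
    fun j k b P => smooth_differentiableAt ((hs j k b).comp contDiff_base) P
  have e1 : ∀ c i j k, pderiv c (fun Q => linearChristoffel T Q (xs k) (x i) (x j)) P
      = (1 / 2) * (pderiv c (fiberLinear (fun b => pderiv i (T j k b))) P
      + pderiv c (fiberLinear (fun b => pderiv j (T i k b))) P
      - pderiv c (fiberLinear (fun b => pderiv k (T i j b))) P) := by
    intro c i j k
    simp only [linearChristoffel]
    rw [pderiv_const_mul c _ (((hl _ _ _ _).fun_add (hl _ _ _ _)).fun_sub (hl _ _ _ _)),
      pderiv_sub c ((hl _ _ _ _).fun_add (hl _ _ _ _)) (hl _ _ _ _),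
      pderiv_add c (hl _ _ _ _) (hl _ _ _ _)]
  have e2 : ∀ c i k p q, pderiv c (fun Q => linearChristoffel T Q (xs k) (x i) (y p q)) P
      = (1 / 2) * pderiv c (fun Q => T i k (p, q) (base Q)) P := fun c i k p q =>
    pderiv_const_mul c _ (hb _ _ _ _)
  have e3 : ∀ c i k p q, pderiv c (fun Q => linearChristoffel T Q (xs k) (y p q) (x i)) P
      = (1 / 2) * pderiv c (fun Q => T i k (p, q) (base Q)) P := fun c i k p q =>
    pderiv_const_mul c _ (hb _ _ _ _)
  have e4 : ∀ c i j p q, pderiv c (fun Q => linearChristoffel T Q (y p q) (x i) (x j)) P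
      = -(1 / 2) * ∑ b, fiberInv (p, q) b * pderiv c (fun Q => T i j b (base Q)) P := by
    intro c i j p q
    simp only [linearChristoffel]
    rw [pderiv_const_mul c _ (DifferentiableAt.fun_sum fun b _ => (hb _ _ _ _).const_mul _),
      pderiv_sum c _ fun b _ => (hb _ _ _ _).const_mul _]
    exact congrArg _ (Finset.sum_congr rfl fun b _ => pderiv_const_mul c _ (hb _ _ _ _))
  have e0 : ∀ c, pderiv c (fun _ : Coord → ℝ => (0 : ℝ)) P = 0 := fun c => pderiv_const c 0 P
  simp only [curvatureOp, christoffel_linearMetric hT, sum_coord]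
  cases l with
  | x l => simp [linearChristoffel, linearCurvatureOp, e0]
  | xs l =>
    cases i <;> cases j <;> cases k
    case x.x.x i j k =>
      simp only [e1, pderiv_x_fiberLinear (hd _ _ _)]
      simp only [linearChristoffel, linearCurvatureOp, baseCurv, zero_mul, mul_zero, sub_zero,
        Finset.sum_const_zero, zero_add, add_zero, pderiv_pderiv_comm hT _ _ j i, Prod.mk.eta]
      have : ∀ f f' g g' : Fin 4 × Fin 2 → ℝ, ∑ b, (-(1 / 2) * (∑ b', fiberInv b b' * f b')
          * (1 / 2 * f' b) - -(1 / 2) * (∑ b', fiberInv b b' * g b') * (1 / 2 * g' b))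
          = -(1 / 4) * ∑ b, ∑ b', fiberInv b b' * (f b * f' b' - g b * g' b') := by
        intro f f' g g'
        simp only [mul_sub, Finset.sum_sub_distrib]
        rw [Finset.sum_comm (f := fun b b' => fiberInv b b' * (f b * f' b')),
          Finset.sum_comm (f := fun b b' => fiberInv b b' * (g b * g' b'))]
        simp only [Finset.mul_sum, Finset.sum_mul, ← Finset.sum_sub_distrib]
        exact Finset.sum_congr rfl fun b _ => Finset.sum_congr rfl fun b' _ => by
          rw [fiberInv_comm]; ring
      rw [this]
      ring
    all_goals
      try simp only [e1, e2, e3, pderiv_x_comp_base (hs _ _ _), pderiv_y_comp_base (hs _ _ _),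
        pderiv_xs_comp_base (hs _ _ _), pderiv_xs_fiberLinear (hd _ _ _), pderiv_y_fiberLinear (hd _ _ _)]
      simp [linearChristoffel, linearCurvatureOp, mixedCurv, e0, hT.symm]
      try ring
  | y p q =>
    cases i <;> cases j <;> cases k <;>
      (try simp only [e4, pderiv_x_comp_base (hs _ _ _), pderiv_y_comp_base (hs _ _ _),
        pderiv_xs_comp_base (hs _ _ _)]) <;>
      simp [linearChristoffel, linearCurvatureOp, mixedCurv, e0]
    case x.x.x i j k =>
      simp only [Finset.mul_sum, ← Finset.sum_neg_distrib,
        ← Finset.sum_add_distrib]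
      exact Finset.sum_congr rfl fun b _ => by ring

omit hT in
-- Lowers the last index of the curvature operator: its values have no `x`-component, so the
-- variable block of the metric plays no role, and `fiberForm` undoes `fiberInv`.
theorem formOf_linearMetric_fiberInv (P : Coord → ℝ) (s : Fin 3 → ℝ) (r : Fin 4 × Fin 2 → ℝ)
    (Z w : Coord → ℝ) (h0 : ∀ l, Z (x l) = 0) (h1 : ∀ l, Z (xs l) = s l)
    (h2 : ∀ b : Fin 4 × Fin 2, Z (y b.1 b.2) = ∑ b', fiberInv b b' * r b') :
    formOf (linearMetric T P) Z w = ∑ l, s l * w (x l) + ∑ b, r b * w (y b.1 b.2) := by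
  rw [linearMetric, formOf_metricWithBlock]
  simp only [h0, h1, h2]
  simp only [mul_zero, zero_mul, Finset.sum_const_zero, zero_add, Finset.mul_sum, Finset.sum_mul]
  congr 1
  rw [Finset.sum_comm]
  refine (Finset.sum_congr rfl fun b' _ => Finset.sum_comm).trans ?_
  refine Finset.sum_congr rfl fun b' _ => ?_
  have h : ∀ d, ∑ b, fiberForm b b' * (fiberInv b d * r d) * w (y b'.1 b'.2)
      = (∑ b, fiberForm b' b * fiberInv b d) * (r d * w (y b'.1 b'.2)) := fun d => by
    rw [Finset.sum_mul]
    exact Finset.sum_congr rfl fun b _ => by rw [fiberForm_comm]; ring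
  simp only [h, sum_fiberForm_mul_fiberInv]
  simp

theorem curvature_linearMetric (P : Coord → ℝ) (v₁ v₂ v₃ v₄ : Coord → ℝ) :
    curvature (linearMetric T) P v₁ v₂ v₃ v₄ =
      ∑ i, ∑ j, ∑ k, ((∑ l, baseCurv T P i j k l * v₁ (x i) * v₂ (x j) * v₃ (x k) * v₄ (x l))
        + ∑ b : Fin 4 × Fin 2, mixedCurv T i j k b (base P)
          * (v₁ (x i) * v₂ (x j) * v₃ (x k) * v₄ (y b.1 b.2)
            - v₁ (x i) * v₂ (x j) * v₄ (x k) * v₃ (y b.1 b.2)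
            + v₃ (x i) * v₄ (x j) * v₁ (x k) * v₂ (y b.1 b.2)
            - v₃ (x i) * v₄ (x j) * v₂ (x k) * v₁ (y b.1 b.2))) := by
  have h0 : ∀ i j k, formOf (linearMetric T P) (fun l => curvatureOp (linearMetric T) P i j k l) v₄
      = ∑ l, linearCurvatureOp T P i j k (xs l) * v₄ (x l)
        + ∑ b : Fin 4 × Fin 2, (match i, j, k with
          | x i, x j, x k => mixedCurv T i j k b (base P)
          | _, _, _ => 0) * v₄ (y b.1 b.2) := by
    intro i j k
    refine formOf_linearMetric_fiberInv P _ _ _ _ (fun l => ?_) (fun l => ?_) fun b => ?_ <;>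
      rw [curvatureOp_linearMetric hT]
    · cases i <;> cases j <;> cases k <;> rfl
    · cases i <;> cases j <;> cases k <;> simp [linearCurvatureOp]
  simp only [curvature, h0, sum_coord]
  simp only [linearCurvatureOp, zero_mul, mul_zero, Finset.sum_const_zero, add_zero, 
    Finset.mul_sum, Prod.mk.eta, Finset.sum_add_distrib, mul_add, mul_sub,
    Finset.sum_sub_distrib]
  -- The `y`-slot may be any of the four arguments. The sums are reordered so that all four
  -- contributions carry the same factor `mixedCurv T i j k b`.
  have hc : ∀ {α β γ δ : Type} [Fintype α] [Fintype β] [Fintype γ] [Fintype δ]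
      (f : α → β → γ → δ → ℝ), ∑ a, ∑ b, ∑ c, ∑ d, f a b c d = ∑ c, ∑ d, ∑ a, ∑ b, f a b c d := by
    intro α β γ δ _ _ _ _ f
    rw [Finset.sum_comm_cycle]
    exact Finset.sum_congr rfl fun c _ => Finset.sum_comm_cycle
  have h1 : ∀ i j : Fin 3, ∑ b : Fin 4 × Fin 2, ∑ k,
      v₁ (x i) * v₂ (x j) * v₃ (y b.1 b.2) * (-mixedCurv T i j k b (base P) * v₄ (x k))
      = -∑ k, ∑ b : Fin 4 × Fin 2, mixedCurv T i j k b (base P)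
        * (v₁ (x i) * v₂ (x j) * v₄ (x k) * v₃ (y b.1 b.2)) := by
    intro i j
    rw [Finset.sum_comm]
    simp only [← Finset.sum_neg_distrib]
    exact Finset.sum_congr rfl fun k _ => Finset.sum_congr rfl fun b _ => by ring
  rw [hc fun i (b : Fin 4 × Fin 2) k l => v₁ (x i) * v₂ (y b.1 b.2) * v₃ (x k)
      * (mixedCurv T k l i b (base P) * v₄ (x l)),
    Finset.sum_comm (f := fun (b : Fin 4 × Fin 2) j => ∑ k, ∑ l, v₁ (y b.1 b.2) * v₂ (x j)
      * v₃ (x k) * (-mixedCurv T k l j b (base P) * v₄ (x l))),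
    hc fun j (b : Fin 4 × Fin 2) k l => v₁ (y b.1 b.2) * v₂ (x j)
      * v₃ (x k) * (-mixedCurv T k l j b (base P) * v₄ (x l))]
  simp only [h1]
  simp only [← Finset.sum_neg_distrib, ← Finset.sum_sub_distrib, ← Finset.sum_add_distrib]
  simp only [add_assoc]
  simp only [← Finset.sum_add_distrib]
  refine Finset.sum_congr rfl fun i _ => Finset.sum_congr rfl fun j _ =>
    Finset.sum_congr rfl fun k _ => congrArg₂ _ ?_ ?_
  · exact Finset.sum_congr rfl fun l _ => by ring
  · exact Finset.sum_congr rfl fun b _ => by ring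

end LinearCurvature

/-! ### Changes of basis adapted to the model. -/

section Model

/-- The bilinear form on fiber vectors with matrix `fiberForm`. -/
def fiberDot (u w : Fin 4 × Fin 2 → ℝ) : ℝ := ∑ b, ∑ b', fiberForm b b' * u b * w b'

theorem fiberDot_comm (u w : Fin 4 × Fin 2 → ℝ) : fiberDot u w = fiberDot w u := by
  unfold fiberDot
  rw [Finset.sum_comm]
  exact Finset.sum_congr rfl fun b _ => Finset.sum_congr rfl fun b' _ => by
    rw [fiberForm_comm]; ring

theorem fiberDot_add_left (u u' w : Fin 4 × Fin 2 → ℝ) :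
    fiberDot (fun b => u b + u' b) w = fiberDot u w + fiberDot u' w := by
  simp only [fiberDot, mul_add, add_mul, Finset.sum_add_distrib]

theorem fiberDot_smul_left (c : ℝ) (u w : Fin 4 × Fin 2 → ℝ) :
    fiberDot (fun b => c * u b) w = c * fiberDot u w := by
  simp only [fiberDot, Finset.mul_sum]
  exact Finset.sum_congr rfl fun b _ => Finset.sum_congr rfl fun b' _ => by ring

theorem fiberDot_add_right (u w w' : Fin 4 × Fin 2 → ℝ) :
    fiberDot u (fun b => w b + w' b) = fiberDot u w + fiberDot u w' := by
  rw [fiberDot_comm, fiberDot_add_left, fiberDot_comm w, fiberDot_comm w']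

theorem fiberDot_smul_right (c : ℝ) (u w : Fin 4 × Fin 2 → ℝ) :
    fiberDot u (fun b => c * w b) = c * fiberDot u w := by
  rw [fiberDot_comm, fiberDot_smul_left, fiberDot_comm]

theorem fiberDot_sum_left (u : Fin 3 → Fin 4 × Fin 2 → ℝ) (a : Fin 3 → ℝ)
    (w : Fin 4 × Fin 2 → ℝ) :
    fiberDot (fun b => ∑ i, u i b * a i) w = ∑ i, a i * fiberDot (u i) w := by
  simp only [Fin.sum_univ_three, fiberDot_add_left]
  simp only [mul_comm _ (a _), fiberDot_smul_left]

/-- The fiber part `D v_y + E v_x` of the adapted change of basis. -/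
def fiberPart (D : Fin 4 × Fin 2 → ℝ) (E : Fin 3 → Fin 4 × Fin 2 → ℝ) (v : Coord → ℝ)
    (b : Fin 4 × Fin 2) : ℝ :=
  D b * v (y b.1 b.2) + ∑ i, E i b * v (x i)

/-- The linear map which is the identity on `x`-components, `fiberPart D E` on the `y`-components,
and whose `x^*`-components are chosen so that `modelForm` pulls back to `metricWithBlock S`. -/
def adaptedMap (S : Matrix (Fin 3) (Fin 3) ℝ) (D : Fin 4 × Fin 2 → ℝ)
    (E : Fin 3 → Fin 4 × Fin 2 → ℝ) : (Coord → ℝ) →ₗ[ℝ] (Coord → ℝ) where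
  toFun v
    | x i => v (x i)
    | xs i => v (xs i) + (1 / 2) * ∑ j, S i j * v (x j)
        - fiberDot (E i) (fun b => D b * v (y b.1 b.2) + (1 / 2) * ∑ j, E j b * v (x j))
    | y p q => fiberPart D E v (p, q)
  map_add' v w := by
    ext c
    cases c with
    | x i => rfl
    | xs i =>
      simp only [Pi.add_apply, mul_add, Finset.sum_add_distrib, fiberDot_add_right]
      ring
    | y p q =>
      simp only [Pi.add_apply, mul_add, Finset.sum_add_distrib, fiberPart]
      ring
  map_smul' a v := by
    ext c
    cases c with
    | x i => rfl
    | xs i =>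
      have h : ∀ b : Fin 4 × Fin 2, D b * (a * v (y b.1 b.2))
          + 1 / 2 * ∑ j, E j b * (a * v (x j))
          = a * (D b * v (y b.1 b.2) + 1 / 2 * ∑ j, E j b * v (x j)) := by
        intro b
        simp only [Fin.sum_univ_three]; ring
      have h' : ∑ j, S i j * (a * v (x j)) = a * ∑ j, S i j * v (x j) := by
        simp only [Fin.sum_univ_three]; ring
      simp only [Pi.smul_apply, smul_eq_mul, h, h', fiberDot_smul_right, RingHom.id_apply]
      ring
    | y p q =>
      simp only [Pi.smul_apply, smul_eq_mul, fiberPart, RingHom.id_apply, Fin.sum_univ_three]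
      ring

/-- `D` is a fibre isometry. The cross terms of `D v_y` and `E w_x` are cancelled by the
`x^*`-correction, while the block `S` and the square of `E` are symmetric, so each of the two
vectors contributes half of them; this explains both factors `1/2` in `adaptedMap`. -/
theorem modelForm_adaptedMap {S : Matrix (Fin 3) (Fin 3) ℝ} (hS : ∀ i j, S i j = S j i)
    {D : Fin 4 × Fin 2 → ℝ} (hD : ∀ b b', fiberForm b b' * (D b * D b') = fiberForm b b')
    (E : Fin 3 → Fin 4 × Fin 2 → ℝ) (v w : Coord → ℝ) :
    modelForm (adaptedMap S D E v) (adaptedMap S D E w) = formOf (metricWithBlock S) v w := by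
  have hy : ∀ u u' : Coord → ℝ, ∑ b : Fin 4 × Fin 2, ∑ b' : Fin 4 × Fin 2,
      fiberForm b b' * u (y b.1 b.2) * u' (y b'.1 b'.2)
      = fiberDot (fun b => u (y b.1 b.2)) fun b => u' (y b.1 b.2) := fun _ _ => rfl
  have hx : ∀ v w : Coord → ℝ, ∑ i, v (x i) * adaptedMap S D E w (xs i)
      = ∑ i, v (x i) * w (xs i) + (1 / 2) * ∑ i, ∑ j, S i j * v (x i) * w (x j)
        - fiberDot (fun b => ∑ i, E i b * v (x i)) (fun b => D b * w (y b.1 b.2)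
          + (1 / 2) * ∑ j, E j b * w (x j)) := by
    intro v w
    rw [fiberDot_sum_left]
    simp only [adaptedMap, LinearMap.coe_mk, AddHom.coe_mk, mul_sub, mul_add,
      Finset.sum_add_distrib, Finset.sum_sub_distrib, Finset.mul_sum]
    congr 2
    exact Finset.sum_congr rfl fun i _ => Finset.sum_congr rfl fun j _ => by ring
  have hSS : ∑ i, ∑ j, S i j * w (x i) * v (x j) = ∑ i, ∑ j, S i j * v (x i) * w (x j) := by
    rw [Finset.sum_comm]
    exact Finset.sum_congr rfl fun i _ => Finset.sum_congr rfl fun j _ => by rw [hS]; ring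
  have hDD : fiberDot (fun b => D b * v (y b.1 b.2)) (fun b => D b * w (y b.1 b.2))
      = fiberDot (fun b => v (y b.1 b.2)) fun b => w (y b.1 b.2) := by
    unfold fiberDot
    exact Finset.sum_congr rfl fun b _ => Finset.sum_congr rfl fun b' _ => by
      conv_rhs => rw [← hD b b']
      ring
  have hx1 : ∀ u i, adaptedMap S D E u (x i) = u (x i) := fun _ _ => rfl
  have hy1 : ∀ u, (fun b : Fin 4 × Fin 2 => adaptedMap S D E u (y b.1 b.2))
      = fun b => D b * u (y b.1 b.2) + ∑ i, E i b * u (x i) := fun _ => rfl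
  have hsum : ∀ u u' : Coord → ℝ, ∑ i, (u (x i) * u' (xs i) + u (xs i) * u' (x i))
      = ∑ i, u (x i) * u' (xs i) + ∑ i, u' (x i) * u (xs i) := by
    intro u u'
    rw [Finset.sum_add_distrib]
    exact congrArg _ (Finset.sum_congr rfl fun i _ => mul_comm _ _)
  rw [modelForm, formOf_metricWithBlock, formOf_metricWithBlock, hy, hy, hsum, hsum]
  simp only [hx1, hy1, hx v w, hx w v, hSS, Matrix.zero_apply, fiberDot_add_left,
    fiberDot_add_right, fiberDot_smul_right, hDD, zero_mul, Finset.sum_const_zero]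
  rw [fiberDot_comm (fun b => ∑ i, E i b * w (x i)) (fun b => ∑ i, E i b * v (x i)),
    fiberDot_comm (fun b => ∑ i, E i b * w (x i))]
  ring

theorem adaptedMap_injective {S : Matrix (Fin 3) (Fin 3) ℝ} (hS : ∀ i j, S i j = S j i)
    {D : Fin 4 × Fin 2 → ℝ} (hD : ∀ b b', fiberForm b b' * (D b * D b') = fiberForm b b')
    (E : Fin 3 → Fin 4 × Fin 2 → ℝ) : Function.Injective (adaptedMap S D E) := by
  rw [injective_iff_map_eq_zero]
  intro v hv
  have h1 : ∀ w, w ⬝ᵥ (metricWithBlock S *ᵥ v) = 0 := by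
    intro w
    have := modelForm_adaptedMap hS hD E w v
    rw [hv] at this
    rw [show w ⬝ᵥ (metricWithBlock S *ᵥ v) = formOf (metricWithBlock S) w v from rfl, ← this]
    simp [modelForm, formOf]
  have h2 : metricWithBlock S *ᵥ v = 0 :=
    dotProduct_eq_zero _ fun w => by rw [dotProduct_comm]; exact h1 w
  exact Matrix.mulVec_injective_of_isUnit
    ((Matrix.isUnit_iff_isUnit_det _).2 (isUnit_det_metricWithBlock S))
    (h2.trans (Matrix.mulVec_zero _).symm)

/-- Contraction of an algebraic curvature tensor in dimension three. -/
theorem sum_curvature_three {σ : Fin 3 → Fin 3 → Fin 3 → Fin 3 → ℝ}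
    (ha : ∀ i j k l, σ i j l k = -σ i j k l) (hp : ∀ i j k l, σ k l i j = σ i j k l)
    (v₁ v₂ v₃ v₄ : Fin 3 → ℝ) :
    ∑ i, ∑ j, ∑ k, ∑ l, σ i j k l * v₁ i * v₂ j * v₃ k * v₄ l =
      σ 0 1 0 1 * ((v₁ 0 * v₂ 1 - v₁ 1 * v₂ 0) * (v₃ 0 * v₄ 1 - v₃ 1 * v₄ 0))
      + σ 0 2 0 2 * ((v₁ 0 * v₂ 2 - v₁ 2 * v₂ 0) * (v₃ 0 * v₄ 2 - v₃ 2 * v₄ 0))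
      + σ 1 2 1 2 * ((v₁ 1 * v₂ 2 - v₁ 2 * v₂ 1) * (v₃ 1 * v₄ 2 - v₃ 2 * v₄ 1))
      + σ 0 1 0 2 * ((v₁ 0 * v₂ 1 - v₁ 1 * v₂ 0) * (v₃ 0 * v₄ 2 - v₃ 2 * v₄ 0)
        + (v₁ 0 * v₂ 2 - v₁ 2 * v₂ 0) * (v₃ 0 * v₄ 1 - v₃ 1 * v₄ 0))
      + σ 0 1 1 2 * ((v₁ 0 * v₂ 1 - v₁ 1 * v₂ 0) * (v₃ 1 * v₄ 2 - v₃ 2 * v₄ 1)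
        + (v₁ 1 * v₂ 2 - v₁ 2 * v₂ 1) * (v₃ 0 * v₄ 1 - v₃ 1 * v₄ 0))
      + σ 0 2 1 2 * ((v₁ 0 * v₂ 2 - v₁ 2 * v₂ 0) * (v₃ 1 * v₄ 2 - v₃ 2 * v₄ 1)
        + (v₁ 1 * v₂ 2 - v₁ 2 * v₂ 1) * (v₃ 0 * v₄ 2 - v₃ 2 * v₄ 0)) := by
  have hd : ∀ i j k, σ i j k k = 0 := fun i j k => by have := ha i j k k; linarith
  have hd' : ∀ i k l, σ i i k l = 0 := fun i k l => by rw [hp k l i i, hd]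
  have ha' : ∀ i j k l, σ j i k l = -σ i j k l := fun i j k l => by rw [hp k l, ha, hp]
  have h1 : ∀ i j, ∑ k, ∑ l, σ i j k l * v₁ i * v₂ j * v₃ k * v₄ l
      = v₁ i * v₂ j * (σ i j 0 1 * (v₃ 0 * v₄ 1 - v₃ 1 * v₄ 0)
        + σ i j 0 2 * (v₃ 0 * v₄ 2 - v₃ 2 * v₄ 0) + σ i j 1 2 * (v₃ 1 * v₄ 2 - v₃ 2 * v₄ 1)) := by
    intro i j
    simp only [Fin.sum_univ_three, hd, ha i j 0 1, ha i j 0 2, ha i j 1 2]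
    ring
  simp only [h1]
  simp only [Fin.sum_univ_three, hd', ha' 0 1, ha' 0 2, ha' 1 2]
  rw [hp 0 2 1 2, hp 0 1 1 2, hp 0 1 0 2]
  ring

end Model

/-! ### The metrics `g_Φ` as members of the linear family. -/

section Specialized

/-- The constant factors in the coefficients of the `x`-block of `g_Φ`. -/
def coeffMatrix : Fin 4 → Fin 2 → Matrix (Fin 3) (Fin 3) ℝ
  | 0, 0 => !![0, 0, 0; 0, 0, 0; 0, 0, -2]
  | 0, 1 => !![0, 0, 0; 0, -2, 0; 0, 0, 0]
  | 1, 0 => !![-2, 0, 0; 0, 0, 0; 0, 0, 0]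
  | 1, 1 => !![0, 0, 0; 0, 0, 0; 0, 0, -2]
  | 2, 0 => !![-2, 0, 0; 0, 0, 0; 0, 0, 0]
  | 2, 1 => !![0, 0, 0; 0, -2, 0; 0, 0, 0]
  | 3, 0 => !![0, 0, 0; 0, 0, 1; 0, 1, 0]
  | 3, 1 => !![0, 0, 1; 0, 0, 0; 1, 0, 0]

/-- The `x`-coordinate on which a coefficient depends. -/
def coeffVar : Fin 4 → Fin 2 → Fin 3 := ![![0, 0], ![1, 1], ![2, 2], ![0, 1]]

/-- The dependence of the coefficients on that coordinate, with `a` and `c` standing for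
`φ_{1,1}` and `φ_{1,2}`. -/
def coeffFun (a c : ℝ → ℝ) : Fin 4 → Fin 2 → ℝ → ℝ := ![![a, c], ![id, id], ![id, id], ![id, id]]

/-- The values of the derivatives of `coeffFun`. -/
def coeffSlope (f h : ℝ) : Fin 4 → Fin 2 → ℝ := ![![f, h], ![1, 1], ![1, 1], ![1, 1]]

/-- The coefficients of the `x`-block of `g_Φ`. -/
def coeff (a c : ℝ → ℝ) (i j : Fin 3) (b : Fin 4 × Fin 2) (p : Fin 3 → ℝ) : ℝ :=
  coeffMatrix b.1 b.2 i j * coeffFun a c b.1 b.2 (p (coeffVar b.1 b.2))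

theorem gPhi_eq_linearMetric {φ : Fin 3 → Fin 2 → ℝ → ℝ} (hφ : IsSpecialized φ) :
    gPhi φ = linearMetric (coeff (φ 0 0) (φ 0 1)) := by
  funext P
  rw [gPhi, linearMetric]
  congr 1
  ext i j
  simp only [Matrix.of_apply, fiberLinear, Fintype.sum_prod_type, Fin.sum_univ_four,
    Fin.sum_univ_two, coeff, base, coeffMatrix, coeffFun, coeffVar]
  fin_cases i <;> fin_cases j <;> simp [hφ.second, hφ.third] <;> ring

/-- The values of the partial derivatives of `coeff`. -/
def coeffDeriv (f h : ℝ) (m i j : Fin 3) (b : Fin 4 × Fin 2) : ℝ :=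
  coeffMatrix b.1 b.2 i j * if m = coeffVar b.1 b.2 then coeffSlope f h b.1 b.2 else 0

variable {a c : ℝ → ℝ}

theorem contDiff_coeffFun (ha : ContDiff ℝ ∞ a) (hc : ContDiff ℝ ∞ c) (k : Fin 4) (l : Fin 2) :
    ContDiff ℝ ∞ (coeffFun a c k l) := by
  have h : ContDiff ℝ ∞ (id : ℝ → ℝ) := contDiff_id
  fin_cases k <;> fin_cases l <;> assumption

theorem deriv_coeffFun (t : ℝ) (k : Fin 4) (l : Fin 2) :
    deriv (coeffFun a c k l) t = coeffSlope (deriv a t) (deriv c t) k l := by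
  have h : deriv (id : ℝ → ℝ) t = 1 := deriv_id t
  fin_cases k <;> fin_cases l <;> simp [coeffFun, coeffSlope, h]

theorem coeffMatrix_comm (k : Fin 4) (l : Fin 2) (i j : Fin 3) :
    coeffMatrix k l i j = coeffMatrix k l j i := by
  fin_cases k <;> fin_cases l <;> fin_cases i <;> fin_cases j <;> simp [coeffMatrix]

theorem isSmoothSymm_coeff (ha : ContDiff ℝ ∞ a) (hc : ContDiff ℝ ∞ c) :
    IsSmoothSymm (coeff a c) where
  symm i j := by
    funext b p
    simp only [coeff, coeffMatrix_comm _ _ i j]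
  smooth i j b :=
    contDiff_const.mul ((contDiff_coeffFun ha hc b.1 b.2).comp (contDiff_apply ℝ ℝ _))

/-- A non-constant slope occurs only in the two coefficients that depend on `x₁`, so the mixed
curvature is a function of `x₁` alone. -/
theorem coeffSlope_var (p : Fin 3 → ℝ) (k : Fin 4) (l : Fin 2) :
    coeffSlope (deriv a (p (coeffVar k l))) (deriv c (p (coeffVar k l))) k l
      = coeffSlope (deriv a (p 0)) (deriv c (p 0)) k l := by
  fin_cases k <;> fin_cases l <;> simp [coeffVar, coeffSlope]

theorem pderiv_coeff (ha : ContDiff ℝ ∞ a) (hc : ContDiff ℝ ∞ c) (m i j : Fin 3)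
    (b : Fin 4 × Fin 2) (p : Fin 3 → ℝ) :
    pderiv m (coeff a c i j b) p = coeffDeriv (deriv a (p 0)) (deriv c (p 0)) m i j b := by
  set n := coeffVar b.1 b.2 with hn
  have h : HasFDerivAt (fun p : Fin 3 → ℝ => coeffFun a c b.1 b.2 (p n))
      (deriv (coeffFun a c b.1 b.2) (p n)
        • (ContinuousLinearMap.proj (R := ℝ) (φ := fun _ : Fin 3 => ℝ) n)) p :=
    (smooth_differentiableAt (contDiff_coeffFun ha hc b.1 b.2) _).hasDerivAt.comp_hasFDerivAt p
      (ContinuousLinearMap.proj (R := ℝ) (φ := fun _ : Fin 3 => ℝ) n).hasFDerivAt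
  unfold coeff coeffDeriv
  rw [pderiv_const_mul m _ h.differentiableAt, pderiv, h.fderiv, deriv_coeffFun, hn,
    coeffSlope_var]
  simp [Pi.single_apply, eq_comm]

theorem mixedCurv_coeff (ha : ContDiff ℝ ∞ a) (hc : ContDiff ℝ ∞ c) (i j k : Fin 3)
    (b : Fin 4 × Fin 2) (p : Fin 3 → ℝ) :
    mixedCurv (coeff a c) i j k b p
      = -(1 / 2) * (coeffDeriv (deriv a (p 0)) (deriv c (p 0)) i j k b
        - coeffDeriv (deriv a (p 0)) (deriv c (p 0)) j i k b) := by
  rw [mixedCurv, pderiv_coeff ha hc, pderiv_coeff ha hc]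

end Specialized

/-! ### Curvature homogeneity of order zero. -/

section ZeroModel

/-- Contraction of the components `R(x_i, x_j, x_k, y_b)` of the curvature of `g_Φ`. -/
theorem sum_mixed_coeffDeriv (f h : ℝ) (W : Fin 3 → Fin 3 → Fin 3 → Fin 4 × Fin 2 → ℝ) :
    ∑ i, ∑ j, ∑ k, ∑ b : Fin 4 × Fin 2,
      -(1 / 2) * (coeffDeriv f h i j k b - coeffDeriv f h j i k b) * W i j k b =
    (W 1 0 0 (1, 0) - W 0 1 0 (1, 0)) + (W 2 0 0 (2, 0) - W 0 2 0 (2, 0))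
      + (W 2 1 1 (2, 1) - W 1 2 1 (2, 1)) + h * (W 0 1 1 (0, 1) - W 1 0 1 (0, 1))
      + f * (W 0 2 2 (0, 0) - W 2 0 2 (0, 0)) + (W 1 2 2 (1, 1) - W 2 1 2 (1, 1))
      - (1 / 2) * (W 0 1 2 (3, 0) - W 1 0 2 (3, 0)) - (1 / 2) * (W 0 2 1 (3, 0) - W 2 0 1 (3, 0))
      - (1 / 2) * (W 1 2 0 (3, 1) - W 2 1 0 (3, 1))
      - (1 / 2) * (W 1 0 2 (3, 1) - W 0 1 2 (3, 1)) := by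
  simp only [Fin.sum_univ_three, Fintype.sum_prod_type, Fin.sum_univ_four, Fin.sum_univ_two,
    coeffDeriv, coeffMatrix, coeffVar, coeffSlope]
  simp
  ring

/-- The change of scale in the fiber that normalizes the curvature of `g_Φ`. -/
def fiberScale (f h : ℝ) (b : Fin 4 × Fin 2) : ℝ := coeffSlope f h b.1 b.2

theorem fiberForm_mul_fiberScale {f h : ℝ} (hfh : f * h = 1) (b b' : Fin 4 × Fin 2) :
    fiberForm b b' * (fiberScale f h b * fiberScale f h b') = fiberForm b b' := by
  have hhf : h * f = 1 := by rw [mul_comm, hfh]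
  obtain ⟨i, j⟩ := b
  obtain ⟨k, l⟩ := b'
  fin_cases i <;> fin_cases j <;> fin_cases k <;> fin_cases l <;>
    simp +decide [fiberForm, metricWithBlock, fiberScale, coeffSlope, hfh, hhf]

/-- The change of basis in the fiber that removes the components `R(x_i, x_j, x_k, x_l)`. -/
def fiberShift (σ : Fin 3 → Fin 3 → Fin 3 → Fin 3 → ℝ) : Fin 3 → Fin 4 × Fin 2 → ℝ
  | 0, (0, 0) => -(1 / 2) * σ 0 2 0 2
  | 0, (0, 1) => -(1 / 2) * σ 0 1 0 1
  | 1, (0, 0) => -σ 0 2 1 2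
  | 1, (1, 1) => -(1 / 2) * σ 1 2 1 2
  | 2, (0, 1) => σ 0 1 1 2
  | 2, (1, 0) => -σ 0 1 0 2
  | _, _ => 0

theorem isZeroCurvatureHomogeneous_linearMetric {a c : ℝ → ℝ} (ha : ContDiff ℝ ∞ a)
    (hc : ContDiff ℝ ∞ c) (hac : ∀ t, deriv a t * deriv c t = 1) :
    IsZeroCurvatureHomogeneous (linearMetric (coeff a c)) modelForm modelCurv := by
  intro P
  have hT := isSmoothSymm_coeff ha hc
  set f := deriv a (base P 0)
  set h := deriv c (base P 0)
  set σ := baseCurv (coeff a c) P with hσ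
  have hS : ∀ i j, Matrix.of (fun i j => fiberLinear (coeff a c i j) P) i j
      = Matrix.of (fun i j => fiberLinear (coeff a c i j) P) j i := fun i j => by
    simp only [Matrix.of_apply, hT.symm i j]
  have hD : ∀ b b', fiberForm b b' * (fiberScale f h b * fiberScale f h b') = fiberForm b b' :=
    fiberForm_mul_fiberScale (hac (base P 0))
  refine ⟨LinearEquiv.ofInjectiveEndo _ (adaptedMap_injective hS hD (fiberShift σ)),
    fun v w => modelForm_adaptedMap hS hD _ v w, fun v₁ v₂ v₃ v₄ => ?_⟩
  have hx : ∀ v i, adaptedMap (Matrix.of (fun i j => fiberLinear (coeff a c i j) P))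
      (fiberScale f h) (fiberShift σ) v (x i) = v (x i) := fun _ _ => rfl
  have hy : ∀ v p q, adaptedMap (Matrix.of (fun i j => fiberLinear (coeff a c i j) P))
      (fiberScale f h) (fiberShift σ) v (y p q)
      = fiberScale f h (p, q) * v (y p q) + ∑ i, fiberShift σ i (p, q) * v (x i) :=
    fun _ _ _ => rfl
  rw [curvature_linearMetric hT]
  simp only [Finset.sum_add_distrib, mixedCurv_coeff ha hc]
  -- In three dimensions `σ` has six independent components, matched one by one by the six nonzero
  -- entries of `fiberShift`. The three diagonal ones arise twice in `elemCurv`, hence their factor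
  -- `1/2`.
  rw [sum_mixed_coeffDeriv, sum_curvature_three (baseCurv_antisymm P) (baseCurv_pair_symm hT P)
    (fun i => v₁ (x i)) (fun i => v₂ (x i)) (fun i => v₃ (x i)) (fun i => v₄ (x i))]
  simp only [LinearEquiv.coe_ofInjectiveEndo, modelCurv, elemCurv, hx, hy, Fin.sum_univ_three,
    fiberShift, fiberScale, coeffSlope, ← hσ]
  simp

  ring

end ZeroModel

/-! ### Rigidity of local isometries within the linear family. -/

section Rigidity

/-- The curvature components `mixedCurv` separate the `x`- and the `y`-directions. -/
structure IsCurvNondegenerate (T : Fin 3 → Fin 3 → Fin 4 × Fin 2 → (Fin 3 → ℝ) → ℝ) : Prop where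
  eq_zero_of_base : ∀ (p z : Fin 3 → ℝ),
    (∀ i j b, ∑ k, mixedCurv T i j k b p * z k = 0) → ∀ k, z k = 0
  eq_zero_of_fiber : ∀ (p : Fin 3 → ℝ) (η : Fin 4 × Fin 2 → ℝ),
    (∀ i j k, ∑ b, mixedCurv T i j k b p * η b = 0) → ∀ b, η b = 0

variable {T T' : Fin 3 → Fin 3 → Fin 4 × Fin 2 → (Fin 3 → ℝ) → ℝ}
  {U : Set (Coord → ℝ)} {H : (Coord → ℝ) → ℝ}

theorem smooth_comp_base {t : (Fin 3 → ℝ) → ℝ} (ht : ContDiff ℝ ∞ t) (Q : Coord → ℝ) :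
    DifferentiableAt ℝ (fun Q : Coord → ℝ => t (base Q)) Q :=
  smooth_differentiableAt (ht.comp contDiff_base) Q

/-- A function whose derivatives along the fibers satisfy the equation of a parallel gradient does
not depend on the `x^*`-coordinates. -/
theorem pderiv_xs_eq_zero (hT : IsSmoothSymm T) (hN : IsCurvNondegenerate T) (hU : IsOpen U)
    (hH : ∀ Q ∈ U, ContDiffAt ℝ ∞ H Q)
    (hxs : ∀ Q ∈ U, ∀ i k, pderiv (x i) (fun Q => pderiv (xs k) H Q) Q = 0)
    (hxy : ∀ Q ∈ U, ∀ i (b : Fin 4 × Fin 2), pderiv (x i) (fun Q => pderiv (y b.1 b.2) H Q) Q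
      = ∑ k, (1 / 2) * T i k b (base Q) * pderiv (xs k) H Q)
    {Q : Coord → ℝ} (hQ : Q ∈ U) (k : Fin 3) : pderiv (xs k) H Q = 0 := by
  refine hN.eq_zero_of_base (base Q) (fun k => pderiv (xs k) H Q) (fun i j b => ?_) k
  have hd : ∀ k, DifferentiableAt ℝ (fun Q => pderiv (xs k) H Q) Q := fun k =>
    differentiableAt_of_smooth (contDiffAt_pderiv (hH Q hQ) _)
  have ht : ∀ i k, DifferentiableAt ℝ (fun Q : Coord → ℝ => (1 / 2) * T i k b (base Q)) Q :=
    fun i k => (smooth_comp_base (hT.smooth i k b) Q).const_mul _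
  -- Differentiating `hxy` costs nothing on the `x^*`-derivatives, by `hxs`. Exchanging `i` and `j`
  -- then leaves exactly the mixed curvature contracted with the `x^*`-gradient.
  have h1 : ∀ i j, pderiv (x j) (fun Q => pderiv (x i) (fun Q => pderiv (y b.1 b.2) H Q) Q) Q
      = ∑ k, (1 / 2) * pderiv j (T i k b) (base Q) * pderiv (xs k) H Q := by
    intro i j
    have : (fun Q => pderiv (x i) (fun Q => pderiv (y b.1 b.2) H Q) Q) =ᶠ[nhds Q]
        fun Q => ∑ k, (1 / 2) * T i k b (base Q) * pderiv (xs k) H Q := by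
      filter_upwards [hU.mem_nhds hQ] with R hR
      exact hxy R hR i b
    rw [pderiv_congr this, pderiv_sum _ _ fun k _ => (ht i k).fun_mul (hd k)]
    refine Finset.sum_congr rfl fun k _ => ?_
    rw [pderiv_mul _ (ht i k) (hd k), hxs Q hQ,
      pderiv_const_mul _ _ (smooth_comp_base (hT.smooth i k b) Q),
      pderiv_x_comp_base (hT.smooth i k b)]
    ring
  have h2 := pderiv_comm (contDiffAt_pderiv (hH Q hQ) (y b.1 b.2)) (x j) (x i)
  rw [h1, h1, ← sub_eq_zero, ← Finset.sum_sub_distrib] at h2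
  rw [← h2]
  exact Finset.sum_congr rfl fun k _ => by rw [mixedCurv]; ring

/-- The `y`-components of the curvature operator of `linearMetric T`. -/
def raisedCurv (T : Fin 3 → Fin 3 → Fin 4 × Fin 2 → (Fin 3 → ℝ) → ℝ) (i j k : Fin 3)
    (b : Fin 4 × Fin 2) (p : Fin 3 → ℝ) : ℝ :=
  ∑ b', fiberInv b b' * mixedCurv T i j k b' p

/-- The integrability condition for the second `x`-derivatives of a function. -/
theorem sum_raisedCurv_mul_pderiv (hT : IsSmoothSymm T) (hU : IsOpen U)
    (hH : ∀ Q ∈ U, ContDiffAt ℝ ∞ H Q)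
    (hy : ∀ Q ∈ U, ∀ i (b : Fin 4 × Fin 2), pderiv (x i) (fun Q => pderiv (y b.1 b.2) H Q) Q = 0)
    {q : Fin 3 → Fin 3 → (Coord → ℝ) → ℝ} (hq : ∀ Q ∈ U, ∀ i j, DifferentiableAt ℝ (q i j) Q)
    (hxx : ∀ Q ∈ U, ∀ i j, pderiv (x i) (fun Q => pderiv (x j) H Q) Q
      = ∑ b : Fin 4 × Fin 2, (-(1 / 2) * ∑ b', fiberInv b b' * T i j b' (base Q))
        * pderiv (y b.1 b.2) H Q - q i j Q)
    {Q : Coord → ℝ} (hQ : Q ∈ U) (i j k : Fin 3) :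
    ∑ b : Fin 4 × Fin 2, raisedCurv T i j k b (base Q) * pderiv (y b.1 b.2) H Q
      = pderiv (x i) (q j k) Q - pderiv (x j) (q i k) Q := by
  have hd : ∀ b : Fin 4 × Fin 2, DifferentiableAt ℝ (fun Q => pderiv (y b.1 b.2) H Q) Q :=
    fun b => differentiableAt_of_smooth (contDiffAt_pderiv (hH Q hQ) _)
  have ht1 : ∀ i j (b b' : Fin 4 × Fin 2),
      DifferentiableAt ℝ (fun Q : Coord → ℝ => fiberInv b b' * T i j b' (base Q)) Q :=
    fun i j b b' => (smooth_comp_base (hT.smooth i j b') Q).const_mul _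
  have ht2 : ∀ i j (b : Fin 4 × Fin 2), DifferentiableAt ℝ
      (fun Q : Coord → ℝ => ∑ b', fiberInv b b' * T i j b' (base Q)) Q :=
    fun i j b => DifferentiableAt.fun_sum fun b' _ => ht1 i j b b'
  have ht3 := fun i j (b : Fin 4 × Fin 2) => (ht2 i j b).const_mul (-(1 / 2))
  have h1 : ∀ i j, pderiv (x i) (fun Q => pderiv (x j) (fun Q => pderiv (x k) H Q) Q) Q
      = ∑ b : Fin 4 × Fin 2, (-(1 / 2) * ∑ b', fiberInv b b' * pderiv i (T j k b') (base Q))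
        * pderiv (y b.1 b.2) H Q - pderiv (x i) (q j k) Q := by
    intro i j
    have : (fun Q => pderiv (x j) (fun Q => pderiv (x k) H Q) Q) =ᶠ[nhds Q]
        fun Q => ∑ b : Fin 4 × Fin 2, (-(1 / 2) * ∑ b', fiberInv b b' * T j k b' (base Q))
        * pderiv (y b.1 b.2) H Q - q j k Q := by
      filter_upwards [hU.mem_nhds hQ] with R hR
      exact hxx R hR j k
    rw [pderiv_congr this, pderiv_sub _ (DifferentiableAt.fun_sum fun b _ =>
      (ht3 j k b).fun_mul (hd b)) (hq Q hQ j k), pderiv_sum _ _ fun b _ => (ht3 j k b).fun_mul (hd b)]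
    refine congrArg₂ _ (Finset.sum_congr rfl fun b _ => ?_) rfl
    rw [pderiv_mul _ (ht3 j k b) (hd b), hy Q hQ, pderiv_const_mul _ _ (ht2 j k b),
      pderiv_sum _ _ fun b' _ => ht1 j k b b', mul_zero, add_zero]
    refine congrArg₂ _ (congrArg _ (Finset.sum_congr rfl fun b' _ => ?_)) rfl
    rw [pderiv_const_mul _ _ (smooth_comp_base (hT.smooth j k b') Q),
      pderiv_x_comp_base (hT.smooth j k b')]
  have h2 := pderiv_comm (contDiffAt_pderiv (hH Q hQ) (x k)) (x i) (x j)
  rw [h1, h1] at h2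
  have h3 : ∑ b : Fin 4 × Fin 2, raisedCurv T i j k b (base Q) * pderiv (y b.1 b.2) H Q
      = ∑ b : Fin 4 × Fin 2, (-(1 / 2) * ∑ b', fiberInv b b' * pderiv i (T j k b') (base Q))
        * pderiv (y b.1 b.2) H Q
      - ∑ b : Fin 4 × Fin 2, (-(1 / 2) * ∑ b', fiberInv b b' * pderiv j (T i k b') (base Q))
        * pderiv (y b.1 b.2) H Q := by
    rw [← Finset.sum_sub_distrib]
    refine Finset.sum_congr rfl fun b _ => ?_
    rw [← sub_mul, ← mul_sub, ← Finset.sum_sub_distrib, raisedCurv, Finset.mul_sum]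
    refine congrArg₂ _ (Finset.sum_congr rfl fun b' _ => ?_) rfl
    rw [mixedCurv]; ring
  rw [h3]
  linarith

/-- Raising the fibre index is invertible, so nondegeneracy of `mixedCurv` passes to `raisedCurv`.
-/
theorem eq_zero_of_sum_raisedCurv (hN : IsCurvNondegenerate T) (p : Fin 3 → ℝ)
    (η : Fin 4 × Fin 2 → ℝ) (h : ∀ i j k, ∑ b, raisedCurv T i j k b p * η b = 0)
    (b : Fin 4 × Fin 2) : η b = 0 := by
  have h1 := hN.eq_zero_of_fiber p (fun b' => ∑ b, fiberInv b b' * η b) fun i j k => by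
    rw [← h i j k]
    simp only [raisedCurv, Finset.mul_sum, Finset.sum_mul]
    rw [Finset.sum_comm]
    exact Finset.sum_congr rfl fun b _ => Finset.sum_congr rfl fun b' _ => by ring
  have h2 : ∑ b', fiberForm b b' * ∑ d, fiberInv d b' * η d = η b := by
    simp only [Finset.mul_sum]
    rw [Finset.sum_comm]
    have : ∀ d, ∑ b', fiberForm b b' * (fiberInv d b' * η d) = (if b = d then 1 else 0) * η d := by
      intro d
      rw [← sum_fiberForm_mul_fiberInv, Finset.sum_mul]
      exact Finset.sum_congr rfl fun b' _ => by rw [fiberInv_comm]; ring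
    simp [this]
  rw [← h2]
  simp [h1]

variable {F : (Coord → ℝ) → (Coord → ℝ)}

section

variable (hT : IsSmoothSymm T) (hT' : IsSmoothSymm T')
  (hF : IsLocalIsometryOn (linearMetric T) (linearMetric T') F U)
include hT hT' hF

theorem pderiv_pderiv_isometry {Q : Coord → ℝ} (hQ : Q ∈ U) (a b k : Coord) :
    pderiv a (fun Q => pderiv b (fun Q => F Q k) Q) Q =
      ∑ d, linearChristoffel T Q d a b * pderiv d (fun Q => F Q k) Q
      - ∑ n, ∑ l, linearChristoffel T' (F Q) k n l * pderiv a (fun Q => F Q n) Q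
        * pderiv b (fun Q => F Q l) Q := by
  rw [hF.pderiv_pderiv (fun _ => isUnit_det_metricWithBlock _)
    (fun _ => isUnit_det_metricWithBlock _)
    (fun P l m => smooth_differentiableAt (contDiff_linearMetric hT' l m) P)
    (linearMetric_comm hT') hQ]
  simp only [christoffel_linearMetric hT, christoffel_linearMetric hT']

/-- The target metric has no Christoffel symbol with upper `x`-index, so the pulled-back
`x`-coordinates have parallel gradients. -/
theorem pderiv_pderiv_x_component {Q : Coord → ℝ} (hQ : Q ∈ U) (a b : Coord) (m : Fin 3) :
    pderiv a (fun Q => pderiv b (fun Q => F Q (x m)) Q) Q =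
      ∑ d, linearChristoffel T Q d a b * pderiv d (fun Q => F Q (x m)) Q := by
  rw [pderiv_pderiv_isometry hT hT' hF hQ]
  simp [linearChristoffel]

variable (hN : IsCurvNondegenerate T)
include hN

theorem pderiv_xs_x_component {Q : Coord → ℝ} (hQ : Q ∈ U) (k m : Fin 3) :
    pderiv (xs k) (fun Q => F Q (x m)) Q = 0 := by
  refine pderiv_xs_eq_zero hT hN hF.isOpen (fun Q hQ => hF.contDiffAt_coord hQ _)
    (fun Q hQ i k => ?_) (fun Q hQ i b => ?_) hQ k <;>
  · rw [pderiv_pderiv_x_component hT hT' hF hQ, sum_coord]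
    simp [linearChristoffel]

theorem pderiv_pderiv_y_x_component {Q : Coord → ℝ} (hQ : Q ∈ U) (a : Coord)
    (b : Fin 4 × Fin 2) (m : Fin 3) :
    pderiv a (fun Q => pderiv (y b.1 b.2) (fun Q => F Q (x m)) Q) Q = 0 := by
  rw [pderiv_pderiv_x_component hT hT' hF hQ, sum_coord]
  cases a <;> simp [linearChristoffel, pderiv_xs_x_component hT hT' hF hN hQ]

/-- With the `x^*`-derivatives gone, the integrability condition holds with zero inhomogeneous term,
so the curvature annihilates the fibre gradient. -/
theorem pderiv_y_x_component {Q : Coord → ℝ} (hQ : Q ∈ U) (b : Fin 4 × Fin 2) (m : Fin 3) :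
    pderiv (y b.1 b.2) (fun Q => F Q (x m)) Q = 0 := by
  refine eq_zero_of_sum_raisedCurv hN (base Q)
    (fun b => pderiv (y b.1 b.2) (fun Q => F Q (x m)) Q) (fun i j k => ?_) b
  rw [sum_raisedCurv_mul_pderiv hT hF.isOpen (fun Q hQ => hF.contDiffAt_coord hQ _)
    (fun Q hQ i b => pderiv_pderiv_y_x_component hT hT' hF hN hQ _ b m)
    (q := fun _ _ _ => 0) (fun Q _ _ _ => differentiableAt_const _) ?_ hQ]
  · simp [pderiv_const]
  · intro Q hQ i j
    rw [pderiv_pderiv_x_component hT hT' hF hQ, sum_coord]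
    simp [linearChristoffel, pderiv_xs_x_component hT hT' hF hN hQ]

theorem pderiv_pderiv_x_component_eq_zero {Q : Coord → ℝ} (hQ : Q ∈ U) (a b : Coord) (m : Fin 3) :
    pderiv a (fun Q => pderiv b (fun Q => F Q (x m)) Q) Q = 0 := by
  rw [pderiv_pderiv_x_component hT hT' hF hQ, sum_coord]
  have h := fun b => pderiv_y_x_component hT hT' hF hN hQ b m
  simp only [pderiv_xs_x_component hT hT' hF hN hQ, h]
  simp [linearChristoffel]

omit hN in
-- The target contributes only `Γ^y_{xx}`, hence only first derivatives of the `x`-components, which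
-- are known to depend on `x` alone once `hN` is available.
theorem pderiv_pderiv_y_component {Q : Coord → ℝ} (hQ : Q ∈ U) (a b : Coord)
    (d : Fin 4 × Fin 2) :
    pderiv a (fun Q => pderiv b (fun Q => F Q (y d.1 d.2)) Q) Q =
      ∑ e, linearChristoffel T Q e a b * pderiv e (fun Q => F Q (y d.1 d.2)) Q
      - ∑ n, ∑ l, (-(1 / 2) * ∑ b', fiberInv d b' * T' n l b' (base (F Q)))
        * pderiv a (fun Q => F Q (x n)) Q * pderiv b (fun Q => F Q (x l)) Q := by
  rw [pderiv_pderiv_isometry hT hT' hF hQ]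
  congr 1
  simp [sum_coord, linearChristoffel]

theorem pderiv_xs_y_component {Q : Coord → ℝ} (hQ : Q ∈ U) (k : Fin 3) (d : Fin 4 × Fin 2) :
    pderiv (xs k) (fun Q => F Q (y d.1 d.2)) Q = 0 := by
  refine pderiv_xs_eq_zero hT hN hF.isOpen (fun Q hQ => hF.contDiffAt_coord hQ _)
    (fun Q hQ i k => ?_) (fun Q hQ i b => ?_) hQ k
  · rw [pderiv_pderiv_y_component hT hT' hF hQ, sum_coord]
    simp [linearChristoffel, pderiv_xs_x_component hT hT' hF hN hQ]
  · rw [pderiv_pderiv_y_component hT hT' hF hQ, sum_coord]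
    simp [linearChristoffel, pderiv_y_x_component hT hT' hF hN hQ]

theorem pderiv_pderiv_y_y_component {Q : Coord → ℝ} (hQ : Q ∈ U) (a : Coord)
    (b d : Fin 4 × Fin 2) :
    pderiv a (fun Q => pderiv (y b.1 b.2) (fun Q => F Q (y d.1 d.2)) Q) Q = 0 := by
  rw [pderiv_pderiv_y_component hT hT' hF hQ, sum_coord]
  have h := fun m => pderiv_y_x_component hT hT' hF hN hQ b m
  simp only [pderiv_xs_y_component hT hT' hF hN hQ, h]
  cases a <;> simp [linearChristoffel]

/-- The transformation law of the `y`-components of the curvature operator. -/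
theorem sum_raisedCurv_isometry {Q : Coord → ℝ} (hQ : Q ∈ U) (i j k : Fin 3)
    (d : Fin 4 × Fin 2) :
    ∑ b : Fin 4 × Fin 2, raisedCurv T i j k b (base Q)
        * pderiv (y b.1 b.2) (fun Q => F Q (y d.1 d.2)) Q
      = ∑ n, ∑ l, ∑ m, raisedCurv T' n l m d (base (F Q)) * pderiv (x i) (fun Q => F Q (x n)) Q
        * pderiv (x j) (fun Q => F Q (x l)) Q * pderiv (x k) (fun Q => F Q (x m)) Q := by
  have hFd : ∀ Q ∈ U, DifferentiableAt ℝ (fun Q => base (F Q)) Q := fun Q hQ =>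
    differentiableAt_pi.2 fun n => differentiableAt_of_smooth (hF.contDiffAt_coord hQ _)
  have hJ : ∀ Q ∈ U, ∀ a m, DifferentiableAt ℝ (fun Q => pderiv a (fun Q => F Q (x m)) Q) Q :=
    fun Q hQ a m => differentiableAt_of_smooth (contDiffAt_pderiv (hF.contDiffAt_coord hQ _) a)
  have ht1 : ∀ Q ∈ U, ∀ n l b', DifferentiableAt ℝ (fun Q => T' n l b' (base (F Q))) Q :=
    fun Q hQ n l b' => (smooth_differentiableAt (hT'.smooth n l b') _).comp Q (hFd Q hQ)
  have ht2 : ∀ Q ∈ U, ∀ n l, DifferentiableAt ℝ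
      (fun Q => -(1 / 2) * ∑ b', fiberInv d b' * T' n l b' (base (F Q))) Q := fun Q hQ n l =>
    (DifferentiableAt.fun_sum fun b' _ => (ht1 Q hQ n l b').const_mul _).const_mul _
  have ht3 : ∀ Q ∈ U, ∀ n l i, DifferentiableAt ℝ
      (fun Q => (-(1 / 2) * ∑ b', fiberInv d b' * T' n l b' (base (F Q)))
        * pderiv (x i) (fun Q => F Q (x n)) Q) Q := fun Q hQ n l i =>
    (ht2 Q hQ n l).fun_mul (hJ Q hQ _ n)
  have ht4 : ∀ Q ∈ U, ∀ n l i j, DifferentiableAt ℝ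
      (fun Q => (-(1 / 2) * ∑ b', fiberInv d b' * T' n l b' (base (F Q)))
        * pderiv (x i) (fun Q => F Q (x n)) Q * pderiv (x j) (fun Q => F Q (x l)) Q) Q :=
    fun Q hQ n l i j => (ht3 Q hQ n l i).fun_mul (hJ Q hQ _ l)
  have h1 : ∀ i j k, pderiv (x i) (fun Q => ∑ n, ∑ l,
      (-(1 / 2) * ∑ b', fiberInv d b' * T' n l b' (base (F Q)))
        * pderiv (x j) (fun Q => F Q (x n)) Q * pderiv (x k) (fun Q => F Q (x l)) Q) Q
      = ∑ l, ∑ m, ∑ n, (-(1 / 2) * ∑ b', fiberInv d b' * pderiv n (T' l m b') (base (F Q)))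
        * pderiv (x i) (fun Q => F Q (x n)) Q
        * pderiv (x j) (fun Q => F Q (x l)) Q * pderiv (x k) (fun Q => F Q (x m)) Q := by
    intro i j k
    rw [pderiv_sum _ _ fun n _ => DifferentiableAt.fun_sum fun l _ => ht4 Q hQ n l j k]
    refine Finset.sum_congr rfl fun l _ => ?_
    rw [pderiv_sum _ _ fun m _ => ht4 Q hQ l m j k]
    refine Finset.sum_congr rfl fun m _ => ?_
    rw [pderiv_mul _ (ht3 Q hQ l m j) (hJ Q hQ _ m), pderiv_mul _ (ht2 Q hQ l m) (hJ Q hQ _ l),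
      pderiv_pderiv_x_component_eq_zero hT hT' hF hN hQ, pderiv_pderiv_x_component_eq_zero hT hT' hF hN hQ,
      pderiv_const_mul _ _ (DifferentiableAt.fun_sum fun b' _ => (ht1 Q hQ l m b').const_mul _),
      pderiv_sum _ _ fun b' _ => (ht1 Q hQ l m b').const_mul _]
    have h2 : ∀ b', pderiv (x i) (fun Q => fiberInv d b' * T' l m b' (base (F Q))) Q
        = ∑ n, fiberInv d b' * (pderiv n (T' l m b') (base (F Q))
          * pderiv (x i) (fun Q => F Q (x n)) Q) := by
      intro b'
      rw [pderiv_const_mul _ _ (ht1 Q hQ l m b'),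
        pderiv_comp (x i) (f := T' l m b') (F := fun Q => base (F Q))
          (smooth_differentiableAt (hT'.smooth l m b') _) (hFd Q hQ), Finset.mul_sum]
      rfl
    simp only [h2, mul_zero, add_zero]
    rw [Finset.sum_comm]
    simp only [Finset.mul_sum, Finset.sum_mul]
    exact Finset.sum_congr rfl fun b' _ => Finset.sum_congr rfl fun n _ => by ring
  -- Here `q` is the pulled-back target symbol `Γ^y_{xx}`. As the `x`-Jacobian is locally constant,
  -- its antisymmetrized derivative is the pulled-back target curvature.
  rw [sum_raisedCurv_mul_pderiv hT hF.isOpen (fun Q hQ => hF.contDiffAt_coord hQ _)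
    (fun Q hQ i b => pderiv_pderiv_y_y_component hT hT' hF hN hQ _ b d)
    (q := fun i j Q => ∑ n, ∑ l, (-(1 / 2) * ∑ b', fiberInv d b' * T' n l b' (base (F Q)))
        * pderiv (x i) (fun Q => F Q (x n)) Q * pderiv (x j) (fun Q => F Q (x l)) Q)
    (fun Q hQ i j => DifferentiableAt.fun_sum fun n _ => DifferentiableAt.fun_sum fun l _ =>
      ht4 Q hQ n l i j) ?_ hQ, h1, h1]
  · have h3 : ∀ n l m, raisedCurv T' n l m d (base (F Q))
        = -(1 / 2) * ∑ b', fiberInv d b' * pderiv n (T' l m b') (base (F Q))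
          - -(1 / 2) * ∑ b', fiberInv d b' * pderiv l (T' n m b') (base (F Q)) := by
      intro n l m
      rw [← mul_sub, ← Finset.sum_sub_distrib, raisedCurv, Finset.mul_sum]
      exact Finset.sum_congr rfl fun b' _ => by rw [mixedCurv]; ring
    simp only [h3, sub_mul, Finset.sum_sub_distrib]
    refine congrArg₂ _ Finset.sum_comm_cycle ?_
    refine Finset.sum_congr rfl fun l _ => ?_
    rw [Finset.sum_comm]
    exact Finset.sum_congr rfl fun n _ => Finset.sum_congr rfl fun m _ => by ring
  · intro Q hQ i j
    rw [pderiv_pderiv_y_component hT hT' hF hQ, sum_coord]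
    simp [linearChristoffel, pderiv_xs_y_component hT hT' hF hN hQ]

theorem fiberForm_isometry {Q : Coord → ℝ} (hQ : Q ∈ U) (b b' : Fin 4 × Fin 2) :
    fiberForm b b' = fiberDot (fun d => pderiv (y b.1 b.2) (fun Q => F Q (y d.1 d.2)) Q)
      fun d => pderiv (y b'.1 b'.2) (fun Q => F Q (y d.1 d.2)) Q := by
  have h1 := hF.metric_eq hQ (y b.1 b.2) (y b'.1 b'.2)
  rw [← formOf_eq_sum (linearMetric T' (F Q)) (fun l => pderiv (y b.1 b.2) (fun Q => F Q l) Q)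
    (fun l => pderiv (y b'.1 b'.2) (fun Q => F Q l) Q), linearMetric, linearMetric,
    formOf_metricWithBlock] at h1
  simp only [pderiv_y_x_component hT hT' hF hN hQ] at h1
  simp only [mul_zero, zero_mul, Finset.sum_const_zero, add_zero, zero_add] at h1
  exact h1

theorem base_jacobian_mul {Q : Coord → ℝ} (hQ : Q ∈ U) (i k : Fin 3) :
    ∑ l, pderiv (x i) (fun Q => F Q (x l)) Q * pderiv (xs k) (fun Q => F Q (xs l)) Q
      = if i = k then 1 else 0 := by
  have h1 := hF.metric_eq hQ (x i) (xs k)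
  rw [← formOf_eq_sum (linearMetric T' (F Q)) (fun l => pderiv (x i) (fun Q => F Q l) Q)
    (fun l => pderiv (xs k) (fun Q => F Q l) Q), linearMetric, linearMetric,
    formOf_metricWithBlock] at h1
  simp only [pderiv_xs_x_component hT hT' hF hN hQ, pderiv_xs_y_component hT hT' hF hN hQ] at h1
  simp only [mul_zero, Finset.sum_const_zero, add_zero, zero_add] at h1
  exact h1.symm

end

end Rigidity

/-! ### Affine action on the base and constant isometry on the fibres. -/

section AffineBase

/-- The `y`-part of the curvature operator applied to three vectors. -/
def curvVector (T : Fin 3 → Fin 3 → Fin 4 × Fin 2 → (Fin 3 → ℝ) → ℝ) (p u v w : Fin 3 → ℝ)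
    (b : Fin 4 × Fin 2) : ℝ :=
  ∑ i, ∑ j, ∑ k, raisedCurv T i j k b p * u i * v j * w k

theorem sum_mul_sum_three (S : Fin 3 → Fin 3 → Fin 3 → ℝ) (A : Matrix (Fin 3) (Fin 3) ℝ)
    (u v w : Fin 3 → ℝ) :
    ∑ i, ∑ j, ∑ k, S i j k * (A *ᵥ u) i * (A *ᵥ v) j * (A *ᵥ w) k
      = ∑ i, ∑ j, ∑ k, (∑ n, ∑ l, ∑ m, S n l m * A n i * A l j * A m k) * u i * v j * w k := by
  simp only [Matrix.mulVec, dotProduct, Fin.sum_univ_three]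
  ring

/-- A local isometry acts on the `x`-coordinates by an affine map, and intertwines the curvature
vectors by a constant isometry of the fibers. -/
theorem IsLocalIsometryOn.exists_affine {T T' : Fin 3 → Fin 3 → Fin 4 × Fin 2 → (Fin 3 → ℝ) → ℝ}
    {U : Set (Coord → ℝ)} {F : (Coord → ℝ) → (Coord → ℝ)} (hT : IsSmoothSymm T)
    (hT' : IsSmoothSymm T') (hF : IsLocalIsometryOn (linearMetric T) (linearMetric T') F U)
    (hN : IsCurvNondegenerate T) {P : Coord → ℝ} {r : ℝ} (hr : 0 < r)
    (hB : Metric.ball P r ⊆ U) :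
    ∃ (X : Matrix (Fin 3) (Fin 3) ℝ) (L : (Fin 4 × Fin 2 → ℝ) → Fin 4 × Fin 2 → ℝ),
      X.det ≠ 0 ∧ (∀ u w, fiberDot (L u) (L w) = fiberDot u w) ∧
      (∀ Q ∈ Metric.ball P r, base (F Q) = base (F P) + X *ᵥ (base Q - base P)) ∧
      ∀ Q ∈ Metric.ball P r, ∀ u v w,
        curvVector T' (base (F Q)) (X *ᵥ u) (X *ᵥ v) (X *ᵥ w) = L (curvVector T (base Q) u v w) := by
  have hP : P ∈ Metric.ball P r := Metric.mem_ball_self hr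
  set X : Matrix (Fin 3) (Fin 3) ℝ := Matrix.of fun m i => pderiv (x i) (fun Q => F Q (x m)) P
    with hX
  have hXc : ∀ Q ∈ Metric.ball P r, ∀ m i, pderiv (x i) (fun Q => F Q (x m)) Q = X m i := by
    intro Q hQ m i
    refine eq_of_pderiv_eq_zero (f := fun Q => pderiv (x i) (fun Q => F Q (x m)) Q)
      (fun R hR => (differentiableAt_of_smooth (contDiffAt_pderiv
        (hF.contDiffAt_coord (hB hR) _) _)).differentiableWithinAt)
      (fun R hR a => pderiv_pderiv_x_component_eq_zero hT hT' hF hN (hB hR) a (x i) m) hQ hP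
  have hLc : ∀ Q ∈ Metric.ball P r, ∀ b d : Fin 4 × Fin 2,
      pderiv (y b.1 b.2) (fun Q => F Q (y d.1 d.2)) Q
        = pderiv (y b.1 b.2) (fun Q => F Q (y d.1 d.2)) P := by
    intro Q hQ b d
    refine eq_of_pderiv_eq_zero (f := fun Q => pderiv (y b.1 b.2) (fun Q => F Q (y d.1 d.2)) Q)
      (fun R hR => (differentiableAt_of_smooth (contDiffAt_pderiv
        (hF.contDiffAt_coord (hB hR) _) _)).differentiableWithinAt)
      (fun R hR a => pderiv_pderiv_y_y_component hT hT' hF hN (hB hR) a b d) hQ hP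
  -- `X` and `L` are the base and fibre Jacobians at `P`. The duality of `x` and `x^*` gives an
  -- inverse of the transpose of `X`, and the `y y`-block of the pullback identity gives
  -- orthogonality of `L`.
  refine ⟨X, fun u d => ∑ b : Fin 4 × Fin 2,
    u b * pderiv (y b.1 b.2) (fun Q => F Q (y d.1 d.2)) P, ?_, ?_, ?_, ?_⟩
  · have h1 : Xᵀ * Matrix.of (fun l k => pderiv (xs k) (fun Q => F Q (xs l)) P) = 1 := by
      ext i k
      rw [Matrix.mul_apply, Matrix.one_apply, ← base_jacobian_mul hT hT' hF hN (hB hP) i k]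
      rfl
    have h2 := congrArg Matrix.det h1
    rw [Matrix.det_mul, Matrix.det_transpose, Matrix.det_one] at h2
    exact left_ne_zero_of_mul_eq_one h2
  · intro u w
    have h1 : ∀ u w : Fin 4 × Fin 2 → ℝ, fiberDot (fun d => ∑ b : Fin 4 × Fin 2,
        u b * pderiv (y b.1 b.2) (fun Q => F Q (y d.1 d.2)) P) w
        = ∑ b : Fin 4 × Fin 2, u b * fiberDot
          (fun d => pderiv (y b.1 b.2) (fun Q => F Q (y d.1 d.2)) P) w := by
      intro u w
      simp only [fiberDot, Finset.mul_sum, Finset.sum_mul]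
      rw [Finset.sum_comm_cycle]
      exact Finset.sum_congr rfl fun b _ => Finset.sum_congr rfl fun d _ =>
        Finset.sum_congr rfl fun d' _ => by ring
    rw [h1]
    conv_rhs => rw [fiberDot]
    refine Finset.sum_congr rfl fun b _ => ?_
    rw [fiberDot_comm, h1, Finset.mul_sum]
    refine Finset.sum_congr rfl fun b' _ => ?_
    rw [fiberDot_comm, ← fiberForm_isometry hT hT' hF hN (hB hP)]
    ring
  · intro Q hQ
    ext m
    have hd1 : ∀ R ∈ Metric.ball P r, DifferentiableAt ℝ (fun Q => F Q (x m)) R := fun R hR =>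
      differentiableAt_of_smooth (hF.contDiffAt_coord (hB hR) _)
    have hd2 : ∀ (R : Coord → ℝ) i, DifferentiableAt ℝ (fun Q : Coord → ℝ => X m i * Q (x i)) R :=
      fun R i => (differentiableAt_apply _ _).const_mul _
    have hd3 : ∀ R : Coord → ℝ, DifferentiableAt ℝ (fun Q : Coord → ℝ => ∑ i, X m i * Q (x i)) R :=
      fun R => DifferentiableAt.fun_sum fun i _ => hd2 R i
    have h1 := eq_of_pderiv_eq_zero (f := fun Q => F Q (x m) - ∑ i, X m i * Q (x i))
      (fun R hR => ((hd1 R hR).fun_sub (hd3 R)).differentiableWithinAt) (fun R hR a => by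
        rw [pderiv_sub a (hd1 R hR) (hd3 R), pderiv_sum a _ fun i _ => hd2 R i]
        have h2 : ∀ i, pderiv a (fun Q : Coord → ℝ => X m i * Q (x i)) R
            = X m i * if a = x i then 1 else 0 := fun i => by
          rw [pderiv_const_mul a _ (differentiableAt_apply _ _), pderiv_coord]
        simp only [h2]
        cases a with
        | x i => simp [hXc R hR]
        | xs i => simp [pderiv_xs_x_component hT hT' hF hN (hB hR)]
        | y p q => simpa using pderiv_y_x_component hT hT' hF hN (hB hR) (p, q) m) hQ hP
    simp only [Pi.add_apply, Matrix.mulVec, dotProduct, Pi.sub_apply, mul_sub,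
      Finset.sum_sub_distrib, base]
    linarith
  · intro Q hQ u v w
    ext d
    have h1 := sum_raisedCurv_isometry hT hT' hF hN (hB hQ)
    simp only [hXc Q hQ, hLc Q hQ] at h1
    rw [curvVector, sum_mul_sum_three]
    simp only [← h1, curvVector, Finset.sum_mul]
    have h2 : ∀ i j, ∑ k, ∑ b : Fin 4 × Fin 2, raisedCurv T i j k b (base Q)
        * pderiv (y b.1 b.2) (fun Q => F Q (y d.1 d.2)) P * u i * v j * w k
        = ∑ b : Fin 4 × Fin 2, ∑ k, raisedCurv T i j k b (base Q)
        * pderiv (y b.1 b.2) (fun Q => F Q (y d.1 d.2)) P * u i * v j * w k := fun i j =>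
      Finset.sum_comm
    simp only [h2]
    have h3 : ∀ i, ∑ j, ∑ b : Fin 4 × Fin 2, ∑ k, raisedCurv T i j k b (base Q)
        * pderiv (y b.1 b.2) (fun Q => F Q (y d.1 d.2)) P * u i * v j * w k
        = ∑ b : Fin 4 × Fin 2, ∑ j, ∑ k, raisedCurv T i j k b (base Q)
        * pderiv (y b.1 b.2) (fun Q => F Q (y d.1 d.2)) P * u i * v j * w k := fun i =>
      Finset.sum_comm
    simp only [h3]
    rw [Finset.sum_comm]
    exact Finset.sum_congr rfl fun b _ => Finset.sum_congr rfl fun i _ =>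
      Finset.sum_congr rfl fun j _ => Finset.sum_congr rfl fun k _ => by ring

end AffineBase

/-! ### Curvature vectors of `g_Φ` and their inner products. -/

section SpecializedRigidity

/-- The components `R(u, v, w, y_b)` of the curvature of `g_Φ`. -/
def mixedVector (f h : ℝ) (u v w : Fin 3 → ℝ) : Fin 4 × Fin 2 → ℝ
  | (0, 0) => f * ((u 0 * v 2 - u 2 * v 0) * w 2)
  | (0, 1) => h * ((u 0 * v 1 - u 1 * v 0) * w 1)
  | (1, 0) => (u 1 * v 0 - u 0 * v 1) * w 0
  | (1, 1) => (u 1 * v 2 - u 2 * v 1) * w 2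
  | (2, 0) => (u 2 * v 0 - u 0 * v 2) * w 0
  | (2, 1) => (u 2 * v 1 - u 1 * v 2) * w 1
  | (3, 0) => -(1 / 2) * ((u 0 * v 1 - u 1 * v 0) * w 2 + (u 0 * v 2 - u 2 * v 0) * w 1)
  | (3, 1) => -(1 / 2) * ((u 1 * v 2 - u 2 * v 1) * w 0 + (u 1 * v 0 - u 0 * v 1) * w 2)

theorem sum_mul_mixedVector (f h : ℝ) (u v w : Fin 3 → ℝ) (η : Fin 4 × Fin 2 → ℝ) :
    ∑ i, ∑ j, ∑ k, ∑ b : Fin 4 × Fin 2,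
      -(1 / 2) * (coeffDeriv f h i j k b - coeffDeriv f h j i k b) * (η b * u i * v j * w k)
    = ∑ b, η b * mixedVector f h u v w b := by
  rw [sum_mixed_coeffDeriv]
  simp only [Fintype.sum_prod_type, Fin.sum_univ_four, Fin.sum_univ_two, mixedVector]
  ring

theorem sum_fiberForm_mul_sum_fiberInv (ν : Fin 4 × Fin 2 → ℝ) (b : Fin 4 × Fin 2) :
    ∑ b', fiberForm b b' * ∑ d, fiberInv b' d * ν d = ν b := by
  simp only [Finset.mul_sum, ← mul_assoc]
  rw [Finset.sum_comm]
  simp only [← Finset.sum_mul, sum_fiberForm_mul_fiberInv]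
  simp

/-- Raising both arguments turns the fibre form into its inverse, so curvature vectors can be paired
through their lowered components `mixedVector`. -/
theorem fiberDot_fiberInv (μ ν : Fin 4 × Fin 2 → ℝ) :
    fiberDot (fun b => ∑ b', fiberInv b b' * μ b') (fun b => ∑ b', fiberInv b b' * ν b')
      = μ (0, 0) * ν (0, 1) + μ (0, 1) * ν (0, 0) + μ (1, 0) * ν (1, 1) + μ (1, 1) * ν (1, 0)
        + μ (2, 0) * ν (2, 1) + μ (2, 1) * ν (2, 0)
        - (8 / 3) * (μ (3, 0) * ν (3, 0) + μ (3, 1) * ν (3, 1))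
        - (4 / 3) * (μ (3, 0) * ν (3, 1) + μ (3, 1) * ν (3, 0)) := by
  have h1 : fiberDot (fun b => ∑ b', fiberInv b b' * μ b') (fun b => ∑ b', fiberInv b b' * ν b')
      = ∑ b, (∑ b', fiberInv b b' * μ b') * ν b := by
    rw [fiberDot]
    refine Finset.sum_congr rfl fun b _ => ?_
    conv_rhs => rw [← sum_fiberForm_mul_sum_fiberInv ν b, Finset.mul_sum]
    exact Finset.sum_congr rfl fun b' _ => by ring
  rw [h1]
  simp only [Fintype.sum_prod_type, Fin.sum_univ_four, Fin.sum_univ_two, fiberInv]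
  simp +decide
  ring

variable {a c : ℝ → ℝ}

theorem curvVector_coeff (ha : ContDiff ℝ ∞ a) (hc : ContDiff ℝ ∞ c) (p u v w : Fin 3 → ℝ) :
    curvVector (coeff a c) p u v w
      = fun b => ∑ b', fiberInv b b' * mixedVector (deriv a (p 0)) (deriv c (p 0)) u v w b' := by
  funext b
  rw [← sum_mul_mixedVector]
  simp only [curvVector, raisedCurv, mixedCurv_coeff ha hc, Finset.sum_mul]
  exact Finset.sum_congr rfl fun i _ => Finset.sum_congr rfl fun j _ =>
    Finset.sum_congr rfl fun k _ => Finset.sum_congr rfl fun b' _ => by ring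

theorem isCurvNondegenerate_coeff (ha : ContDiff ℝ ∞ a) (hc : ContDiff ℝ ∞ c)
    (hac : ∀ t, deriv a t * deriv c t = 1) : IsCurvNondegenerate (coeff a c) where
  eq_zero_of_base p z h := by
    simp only [mixedCurv_coeff ha hc, Fin.sum_univ_three, coeffDeriv] at h
    have h0 := h 1 0 (1, 0)
    have h1 := h 2 1 (2, 1)
    have h2 := h 1 2 (1, 1)
    simp [coeffMatrix, coeffVar, coeffSlope] at h0 h1 h2
    intro k
    fin_cases k <;> simp [h0, h1, h2]
  eq_zero_of_fiber p η h := by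
    have hf : deriv a (p 0) ≠ 0 := left_ne_zero_of_mul_eq_one (hac _)
    have hh : deriv c (p 0) ≠ 0 := right_ne_zero_of_mul_eq_one (hac _)
    have key : ∀ u v w : Fin 3 → ℝ,
        ∑ b, η b * mixedVector (deriv a (p 0)) (deriv c (p 0)) u v w b = 0 := by
      intro u v w
      rw [← sum_mul_mixedVector]
      refine Finset.sum_eq_zero fun i _ => Finset.sum_eq_zero fun j _ =>
        Finset.sum_eq_zero fun k _ => ?_
      rw [← zero_mul (u i * v j * w k), ← h i j k, Finset.sum_mul]
      exact Finset.sum_congr rfl fun b _ => by rw [mixedCurv_coeff ha hc]; ring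
    -- Each of these eight triples of basis vectors makes exactly one component of `mixedVector`
    -- nonzero.
    have h00 := key ![1, 0, 0] ![0, 0, 1] ![0, 0, 1]
    have h01 := key ![1, 0, 0] ![0, 1, 0] ![0, 1, 0]
    have h10 := key ![0, 1, 0] ![1, 0, 0] ![1, 0, 0]
    have h11 := key ![0, 1, 0] ![0, 0, 1] ![0, 0, 1]
    have h20 := key ![0, 0, 1] ![1, 0, 0] ![1, 0, 0]
    have h21 := key ![0, 0, 1] ![0, 1, 0] ![0, 1, 0]
    have h30 := key ![1, 0, 0] ![0, 0, 1] ![0, 1, 0]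
    have h31 := key ![0, 1, 0] ![0, 0, 1] ![1, 0, 0]
    simp [Fintype.sum_prod_type, Fin.sum_univ_four, mixedVector, hf, hh] at h00 h01 h10 h11 h20 h21 h30 h31
    rintro ⟨i, j⟩
    fin_cases i <;> fin_cases j <;> simp [h00, h01, h10, h11, h20, h21, h30, h31]

/-- A linear map of the plane, with columns `(v₁, v₂)` and `(w₁, w₂)`, which matches the forms built
from two non-constant families `f`, `f'` along a reparametrization `τ`, preserves or exchanges the
axes, so `f` is a constant multiple of `f' ∘ τ` or of its inverse `h' ∘ τ`. -/
theorem axes_of_form_eq {α v₁ v₂ w₁ w₂ : ℝ} {f h f' h' : ℝ → ℝ} {τ : ℝ → ℝ} {I : Set ℝ}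
    (hfh : ∀ t, f t * h t = 1) (hfh' : ∀ t, f' t * h' t = 1) (hα : α ≠ 0)
    (hdet : v₁ * w₂ - w₁ * v₂ ≠ 0)
    (key : ∀ s ∈ I, ∀ s' ∈ I, ∀ p q p' q' : ℝ,
      f s * h s' * (q ^ 2 * p' ^ 2) + h s * f s' * (p ^ 2 * q' ^ 2) - 2 * (p * q * p' * q')
      = α ^ 2 * (f' (τ s) * h' (τ s') * ((p * v₂ + q * w₂) ^ 2 * (p' * v₁ + q' * w₁) ^ 2)
        + h' (τ s) * f' (τ s') * ((p * v₁ + q * w₁) ^ 2 * (p' * v₂ + q' * w₂) ^ 2)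
        - 2 * ((p * v₁ + q * w₁) * (p * v₂ + q * w₂) * (p' * v₁ + q' * w₁)
          * (p' * v₂ + q' * w₂))))
    {s₀ s₁ : ℝ} (h₀ : s₀ ∈ I) (h₁ : s₁ ∈ I) (hne : f' (τ s₀) ≠ f' (τ s₁)) :
    (∀ s ∈ I, h s₀ * f s = h' (τ s₀) * f' (τ s)) ∨ (∀ s ∈ I, h s₀ * f s = f' (τ s₀) * h' (τ s)) := by
  -- Writing `ρ` for the quotient of the two values of `f'`, this is `ρ + 1/ρ - 2 = (ρ - 1)²/ρ`.
  have hm : f' (τ s₀) * h' (τ s₁) + h' (τ s₀) * f' (τ s₁) - 2 ≠ 0 := by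
    intro e
    have e0 := hfh' (τ s₀)
    have e1 := hfh' (τ s₁)
    have : (f' (τ s₀) - f' (τ s₁)) ^ 2 = 0 := by
      linear_combination (f' (τ s₀) * f' (τ s₁)) * e - f' (τ s₁) ^ 2 * e0 - f' (τ s₀) ^ 2 * e1
    exact hne (sub_eq_zero.1 (pow_eq_zero_iff two_ne_zero |>.1 this))
  -- When both arguments are the same axis vector the left side of `key` vanishes, while the right
  -- side is a nonzero multiple of `(v₁ v₂)²`.
  have hv : v₁ * v₂ = 0 := by
    have e := key s₀ h₀ s₁ h₁ 1 0 1 0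
    have : (α ^ 2 * (f' (τ s₀) * h' (τ s₁) + h' (τ s₀) * f' (τ s₁) - 2)) * (v₁ * v₂) ^ 2 = 0 := by
      linear_combination -e
    simpa [hα, hm] using this
  have hw : w₁ * w₂ = 0 := by
    have e := key s₀ h₀ s₁ h₁ 0 1 0 1
    have : (α ^ 2 * (f' (τ s₀) * h' (τ s₁) + h' (τ s₀) * f' (τ s₁) - 2)) * (w₁ * w₂) ^ 2 = 0 := by
      linear_combination -e
    simpa [hα, hm] using this
  have e0 := hfh s₀
  have e0' := hfh' (τ s₀)
  rcases mul_eq_zero.1 hv with hv1 | hv2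
  · right
    have hw2 : w₂ = 0 := by
      rcases mul_eq_zero.1 hw with hw1 | hw2
      · exact absurd (by rw [hv1, hw1]; ring) hdet
      · exact hw2
    intro s hs
    have e1 := key s₀ h₀ s hs 1 0 0 1
    -- The case of equal parameters fixes the constant: `α² v₂² w₁² = 1`.
    have e2 := key s₀ h₀ s₀ h₀ 1 0 0 1
    rw [hv1, hw2] at e1 e2
    linear_combination e1 - (f' (τ s₀) * h' (τ s)) * (e2 - e0 + α ^ 2 * v₂ ^ 2 * w₁ ^ 2 * e0')
  · left
    have hw1 : w₁ = 0 := by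
      rcases mul_eq_zero.1 hw with hw1 | hw2
      · exact hw1
      · exact absurd (by rw [hv2, hw2]; ring) hdet
    intro s hs
    have e1 := key s₀ h₀ s hs 1 0 0 1
    have e2 := key s₀ h₀ s₀ h₀ 1 0 0 1
    rw [hv2, hw1] at e1 e2
    linear_combination e1 - (h' (τ s₀) * f' (τ s)) * (e2 - e0 + α ^ 2 * v₁ ^ 2 * w₂ ^ 2 * e0')

end SpecializedRigidity

/-! ### Transformation of `φ_{1,1}'` and invariance of `Ξ`. -/

section Invariance

variable {a c a' c' : ℝ → ℝ}

theorem dist_add_smul_single (P : Coord → ℝ) (t : ℝ) (k : Coord) :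
    dist (P + t • Pi.single k (1 : ℝ)) P = |t| := by
  rw [dist_eq_norm, add_sub_cancel_left, norm_smul, Pi.norm_single]
  simp

theorem base_add_smul_single (P : Coord → ℝ) (t : ℝ) (i : Fin 3) :
    base (P + t • Pi.single (x i) (1 : ℝ)) = base P + t • Pi.single i (1 : ℝ) := by
  ext k
  simp [base, Pi.single_apply]

/-- Under a local isometry, `φ_{1,1}'` is transformed by an affine change of variable, a constant
factor, and possibly an inversion. -/
theorem deriv_eq_of_isometry (ha : ContDiff ℝ ∞ a) (hc : ContDiff ℝ ∞ c)
    (hac : ∀ t, deriv a t * deriv c t = 1) (ha' : ContDiff ℝ ∞ a') (hc' : ContDiff ℝ ∞ c')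
    (hac' : ∀ t, deriv a' t * deriv c' t = 1) (hinj : Function.Injective (deriv a'))
    {U : Set (Coord → ℝ)} {F : (Coord → ℝ) → (Coord → ℝ)}
    (hF : IsLocalIsometryOn (linearMetric (coeff a c)) (linearMetric (coeff a' c')) F U)
    {P : Coord → ℝ} (hP : P ∈ U) :
    ∃ α K : ℝ, α ≠ 0 ∧ K ≠ 0 ∧
      ((∀ᶠ s in nhds (P (x 0)), deriv a s = K * deriv a' (F P (x 0) + α * (s - P (x 0)))) ∨
        ∀ᶠ s in nhds (P (x 0)), deriv a s = K * deriv c' (F P (x 0) + α * (s - P (x 0)))) := by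
  obtain ⟨r, hr, hB⟩ := Metric.isOpen_iff.1 hF.isOpen P hP
  obtain ⟨X, L, hdet, hL, hbase, hcurv⟩ := hF.exists_affine (isSmoothSymm_coeff ha hc)
    (isSmoothSymm_coeff ha' hc') (isCurvNondegenerate_coeff ha hc hac) hr hB
  have hXu : IsUnit X := (Matrix.isUnit_iff_isUnit_det _).2 (isUnit_iff_ne_zero.2 hdet)
  have hsurj : ∀ u, ∃ v, X *ᵥ v = u := Matrix.mulVec_surjective_iff_isUnit.2 hXu
  have hmem : ∀ t k, |t| < r → P + t • Pi.single k (1 : ℝ) ∈ Metric.ball P r := fun t k ht => by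
    rwa [Metric.mem_ball, dist_add_smul_single]
  have hF0 : ∀ t i, |t| < r → base (F (P + t • Pi.single (x i) (1 : ℝ))) 0
      = base (F P) 0 + t * X 0 i := by
    intro t i ht
    rw [hbase _ (hmem t (x i) ht), base_add_smul_single, add_sub_cancel_left]
    simp [Matrix.mulVec_smul]
  have hPB : P ∈ Metric.ball P r := Metric.mem_ball_self hr
  -- the first row of the linear part
  have hrow : ∀ i, i ≠ 0 → X 0 i = 0 := by
    intro i hi
    have ht : |r / 2| < r := by rw [abs_of_pos (by positivity)]; linarith
    have hQ := hmem (r / 2) (x i) ht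
    -- A step in the direction of `x₂` or `x₃` leaves the source curvature vectors unchanged, hence
    -- the target ones too. One of their components is `deriv a'` itself, and by injectivity the
    -- first coordinate of the image cannot move.
    have h1 : ∀ u v w, curvVector (coeff a' c') (base (F (P + (r / 2) • Pi.single (x i) (1 : ℝ))))
        u v w = curvVector (coeff a' c') (base (F P)) u v w := by
      intro u v w
      obtain ⟨u, rfl⟩ := hsurj u
      obtain ⟨v, rfl⟩ := hsurj v
      obtain ⟨w, rfl⟩ := hsurj w
      rw [hcurv _ hQ, hcurv _ hPB, curvVector_coeff ha hc, curvVector_coeff ha hc,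
        base_add_smul_single]
      simp [hi.symm]
    have h2 := congrFun (h1 ![1, 0, 0] ![0, 0, 1] ![0, 0, 1]) (0, 1)
    rw [curvVector_coeff ha' hc', curvVector_coeff ha' hc'] at h2
    simp +decide [Fintype.sum_prod_type, fiberInv, mixedVector] at h2
    have h3 := hinj h2
    rw [hF0 _ _ ht] at h3
    have h4 : r / 2 * X 0 i = 0 := by linarith
    exact (mul_eq_zero.1 h4).resolve_left (by positivity)
  have h01 := hrow 1 (by decide)
  have h02 := hrow 2 (by decide)
  have hdet' : X.det = X 0 0 * (X 1 1 * X 2 2 - X 1 2 * X 2 1) := by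
    rw [Matrix.det_fin_three, h01, h02]; ring
  rw [hdet'] at hdet
  have hα := left_ne_zero_of_mul hdet
  have hD := right_ne_zero_of_mul hdet
  set s₀ := P (x 0) with hs₀
  set t₀ := F P (x 0) with ht₀
  have hbt : ∀ s, |s - s₀| < r → base (F (P + (s - s₀) • Pi.single (x 0) (1 : ℝ))) 0
      = t₀ + X 0 0 * (s - s₀) := by
    intro s hs
    rw [hF0 _ _ hs, mul_comm]; rfl
  have hbs : ∀ s, base (P + (s - s₀) • Pi.single (x 0) (1 : ℝ)) 0 = s := by
    intro s
    rw [base_add_smul_single]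
    simp [base, hs₀]
  have key : ∀ s ∈ {s | |s - s₀| < r}, ∀ s' ∈ {s | |s - s₀| < r}, ∀ p q p' q' : ℝ,
      deriv a s * deriv c s' * (q ^ 2 * p' ^ 2) + deriv c s * deriv a s' * (p ^ 2 * q' ^ 2)
        - 2 * (p * q * p' * q')
      = X 0 0 ^ 2 * (deriv a' (t₀ + X 0 0 * (s - s₀)) * deriv c' (t₀ + X 0 0 * (s' - s₀))
          * ((p * X 2 1 + q * X 2 2) ^ 2 * (p' * X 1 1 + q' * X 1 2) ^ 2)
        + deriv c' (t₀ + X 0 0 * (s - s₀)) * deriv a' (t₀ + X 0 0 * (s' - s₀))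
          * ((p * X 1 1 + q * X 1 2) ^ 2 * (p' * X 2 1 + q' * X 2 2) ^ 2)
        - 2 * ((p * X 1 1 + q * X 1 2) * (p * X 2 1 + q * X 2 2) * (p' * X 1 1 + q' * X 1 2)
          * (p' * X 2 1 + q' * X 2 2))) := by
    intro s hs s' hs' p q p' q'
    -- With first vector `e₁` and equal second and third vectors orthogonal to `e₁`, the lowered
    -- components `(1,0)` and `(2,0)` vanish, also after applying `X`. The pairing thus involves
    -- only `β_{1,j}` and `β_{4,j}`, and the latter contribute the constant `-2`.
    have e := hL (curvVector (coeff a c) (base (P + (s - s₀) • Pi.single (x 0) (1 : ℝ)))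
        ![1, 0, 0] ![0, p, q] ![0, p, q])
      (curvVector (coeff a c) (base (P + (s' - s₀) • Pi.single (x 0) (1 : ℝ)))
        ![1, 0, 0] ![0, p', q'] ![0, p', q'])
    rw [← hcurv _ (hmem _ _ hs), ← hcurv _ (hmem _ _ hs')] at e
    simp only [curvVector_coeff ha hc, curvVector_coeff ha' hc', hbt s hs, hbt s' hs', hbs,
      fiberDot_fiberInv, mixedVector] at e
    simp [Matrix.mulVec, dotProduct, Fin.sum_univ_three, h01, h02] at e
    linear_combination -e
  have hr2 : |s₀ + r / 2 - s₀| < r := by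
    rw [add_sub_cancel_left, abs_of_pos (by positivity)]; linarith
  have h00 : |s₀ - s₀| < r := by simpa using hr
  -- Two parameters where the target slopes differ are needed to detect the axes; `s₀ + r / 2` is
  -- any second point in range.
  have hne : deriv a' (t₀ + X 0 0 * (s₀ - s₀)) ≠ deriv a' (t₀ + X 0 0 * (s₀ + r / 2 - s₀)) := by
    intro e
    have e1 := hinj e
    have e2 : X 0 0 * (r / 2) = 0 := by linarith
    exact mul_ne_zero hα (by positivity) e2
  have hmem' : ∀ᶠ s in nhds s₀, s ∈ {s | |s - s₀| < r} := by
    filter_upwards [Metric.ball_mem_nhds s₀ hr] with s hs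
    rwa [Metric.mem_ball, Real.dist_eq] at hs
  have hf0 : ∀ t, deriv a t ≠ 0 := fun t => left_ne_zero_of_mul_eq_one (hac t)
  have hf0' : ∀ t, deriv a' t ≠ 0 := fun t => left_ne_zero_of_mul_eq_one (hac' t)
  have hh0' : ∀ t, deriv c' t ≠ 0 := fun t => right_ne_zero_of_mul_eq_one (hac' t)
  rcases axes_of_form_eq (τ := fun s => t₀ + X 0 0 * (s - s₀)) hac hac' hα
    hD key h00 hr2 hne with h | h
  · refine ⟨X 0 0, deriv a s₀ * deriv c' (t₀ + X 0 0 * (s₀ - s₀)), hα,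
      mul_ne_zero (hf0 _) (hh0' _), Or.inl ?_⟩
    filter_upwards [hmem'] with s hs
    linear_combination (deriv a s₀) * h s hs - deriv a s * hac s₀
  · refine ⟨X 0 0, deriv a s₀ * deriv a' (t₀ + X 0 0 * (s₀ - s₀)), hα,
      mul_ne_zero (hf0 _) (hf0' _), Or.inr ?_⟩
    filter_upwards [hmem'] with s hs
    linear_combination (deriv a s₀) * h s hs - deriv a s * hac s₀

/-- The expression `(1 - f f'' (f')⁻²)²`. -/
def logInvariant (f : ℝ → ℝ) (t : ℝ) : ℝ :=
  (1 - f t * deriv (deriv f) t / (deriv f t) ^ 2) ^ 2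

/-- Where `f' ≠ 0` the expression is `((f/f')')²`. The factor `K` cancels in `f/f'`, and the factor
`1/α` produced there is undone by the outer derivative. -/
theorem logInvariant_of_affine {f g : ℝ → ℝ} {α K s₀ t₀ : ℝ} (hα : α ≠ 0) (hK : K ≠ 0)
    (h : ∀ᶠ s in nhds s₀, f s = K * g (t₀ + α * (s - s₀))) :
    logInvariant f s₀ = logInvariant g t₀ := by
  have hcomp : ∀ g : ℝ → ℝ, deriv (fun s => g (t₀ + α * (s - s₀)))
      = fun s => α * deriv g (t₀ + α * (s - s₀)) := by
    intro g
    funext s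
    have e1 : (fun s => g (t₀ + α * (s - s₀))) = fun s => g (α * s + (t₀ - α * s₀)) := by
      funext s; congr 1; ring
    have e2 : (fun s => g (α * s + (t₀ - α * s₀)))
        = fun s => (fun z => g (z + (t₀ - α * s₀))) (α * s) := rfl
    rw [e1, e2, deriv_comp_mul_left α (fun z => g (z + (t₀ - α * s₀))) s, deriv_comp_add_const,
      smul_eq_mul]
    congr 2; ring
  have h1 : deriv f =ᶠ[nhds s₀] fun s => K * (α * deriv g (t₀ + α * (s - s₀))) := by
    filter_upwards [h.eventually_nhds] with s hs
    rw [Filter.EventuallyEq.deriv_eq hs, deriv_const_mul_field, hcomp]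
  have h2 : deriv (deriv f) s₀ = K * (α * (α * deriv (deriv g) t₀)) := by
    rw [h1.deriv_eq, deriv_const_mul_field, deriv_const_mul_field, hcomp]
    simp
  have h3 := h.self_of_nhds
  have h4 := h1.self_of_nhds
  simp only [sub_self, mul_zero, add_zero] at h3 h4
  rw [logInvariant, logInvariant, h2, h3, h4]
  congr 2
  -- If the derivative vanishes, both quotients are zero by the convention for division by zero.
  by_cases hg : deriv g t₀ = 0
  · simp [hg]
  · field_simp

/-- For `g = 1/f` one has `g/g' = -f/f'`; the outer square in `Ξ` is there to absorb this sign. -/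
theorem logInvariant_of_mul_eq_one {f g : ℝ → ℝ} (hf : ContDiff ℝ ∞ f)
    (hfg : ∀ t, f t * g t = 1) {t : ℝ} (hf' : deriv f t ≠ 0) :
    logInvariant g t = logInvariant f t := by
  have hf0 : ∀ t, f t ≠ 0 := fun t => left_ne_zero_of_mul_eq_one (hfg t)
  have hg : g = fun t => (f t)⁻¹ := funext fun t => eq_inv_of_mul_eq_one_right (hfg t)
  have hd : ∀ t, DifferentiableAt ℝ f t := smooth_differentiableAt hf
  have hd' : ∀ t, DifferentiableAt ℝ (deriv f) t :=
    smooth_differentiableAt ((contDiff_infty_iff_deriv.1 hf).2)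
  have h1 : deriv g = fun t => -deriv f t / f t ^ 2 := by
    funext t
    rw [hg]
    exact ((hd t).hasDerivAt.inv (hf0 t)).deriv
  have h2 : deriv (deriv g) t = (-deriv (deriv f) t * f t ^ 2
      - -deriv f t * (2 * f t * deriv f t)) / (f t ^ 2) ^ 2 := by
    rw [h1]
    have e := ((hd' t).hasDerivAt.neg.div ((hd t).hasDerivAt.pow 2) (pow_ne_zero 2 (hf0 t))).deriv
    exact e.trans (by simp)
  have hft := hf0 t
  rw [logInvariant, logInvariant, h2, h1, hg]
  field_simp
  ring

theorem Xi_eq_logInvariant (φ : Fin 3 → Fin 2 → ℝ → ℝ) (P : Coord → ℝ) :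
    Xi φ P = logInvariant (deriv (φ 0 0)) (P (x 0)) := by
  simp only [Xi, logInvariant, iteratedDeriv_succ, iteratedDeriv_zero]

namespace IsSpecialized

variable {φ ψ : Fin 3 → Fin 2 → ℝ → ℝ}

theorem contDiff (hφ : IsSpecialized φ) (j : Fin 2) : ContDiff ℝ ∞ (φ 0 j) :=
  (contDiffOn_univ.1 (hφ.analytic j).contDiffOn_of_completeSpace)

theorem deriv_deriv_ne_zero (hφ : IsSpecialized φ) (j : Fin 2) (t : ℝ) :
    deriv (deriv (φ 0 j)) t ≠ 0 := by
  simpa only [iteratedDeriv_succ, iteratedDeriv_zero] using hφ.second_deriv_ne_zero j t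

/-- Rolle's theorem, since the second derivative never vanishes. Injectivity is what lets curvature
detect the coordinate `x₁`. -/
theorem deriv_injective (hφ : IsSpecialized φ) (j : Fin 2) :
    Function.Injective (deriv (φ 0 j)) := by
  have hcont : Continuous (deriv (φ 0 j)) := ((contDiff_infty_iff_deriv.1 (hφ.contDiff j)).2).continuous
  have key : ∀ s t, s < t → deriv (φ 0 j) s ≠ deriv (φ 0 j) t := fun s t hst h => by
    obtain ⟨ξ, -, hξ⟩ := exists_deriv_eq_zero hst hcont.continuousOn h
    exact hφ.deriv_deriv_ne_zero j ξ hξ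
  intro s t h
  rcases lt_trichotomy s t with hst | hst | hst
  · exact absurd h (key s t hst)
  · exact hst
  · exact absurd h.symm (key t s hst)

/-- `Ξ` is preserved by local isometries. -/
theorem Xi_isometry (hφ : IsSpecialized φ) (hψ : IsSpecialized ψ) {U : Set (Coord → ℝ)}
    {F : (Coord → ℝ) → (Coord → ℝ)} (hF : IsLocalIsometryOn (gPhi φ) (gPhi ψ) F U)
    {P : Coord → ℝ} (hP : P ∈ U) : Xi ψ (F P) = Xi φ P := by
  rw [gPhi_eq_linearMetric hφ, gPhi_eq_linearMetric hψ] at hF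
  obtain ⟨α, K, hα, hK, h⟩ := deriv_eq_of_isometry (hφ.contDiff 0) (hφ.contDiff 1)
    hφ.deriv_mul_deriv (hψ.contDiff 0) (hψ.contDiff 1) hψ.deriv_mul_deriv (hψ.deriv_injective 0)
    hF hP
  rw [Xi_eq_logInvariant, Xi_eq_logInvariant]
  rcases h with h | h
  · exact (logInvariant_of_affine hα hK h).symm
  · rw [logInvariant_of_affine hα hK h]
    exact (logInvariant_of_mul_eq_one (contDiff_infty_iff_deriv.1 (hψ.contDiff 0)).2
      hψ.deriv_mul_deriv (hψ.deriv_deriv_ne_zero 0 _)).symm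

end IsSpecialized

end Invariance

/-! ### Non-constancy of `Ξ`. -/

section Inhomogeneity

/-- If `(1 - f f'' (f')⁻²)²` is locally constant, then `f` is an exponential function. -/
theorem exists_eq_exp_of_logInvariant {f : ℝ → ℝ} (hf : AnalyticOnNhd ℝ f Set.univ)
    (hf0 : ∀ t, f t ≠ 0) (hf1 : ∀ t, deriv f t ≠ 0) {k s₀ : ℝ}
    (h : ∀ᶠ s in nhds s₀, logInvariant f s = k) :
    ∃ b c : ℝ, ∀ t, f t = b * Real.exp (c * t) := by
  have hd : ∀ t, HasDerivAt f (deriv f t) t := fun t =>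
    (hf t trivial).differentiableAt.hasDerivAt
  have hd' : ∀ t, HasDerivAt (deriv f) (deriv (deriv f) t) t := fun t =>
    (hf.deriv t trivial).differentiableAt.hasDerivAt
  set v : ℝ → ℝ := fun t => f t / deriv f t with hv
  have hva : AnalyticOnNhd ℝ v Set.univ := hf.div hf.deriv fun t _ => hf1 t
  have hv1 : ∀ t, deriv v t = 1 - f t * deriv (deriv f) t / (deriv f t) ^ 2 := by
    intro t
    have e : deriv v t = (deriv f t * deriv f t - f t * deriv (deriv f) t) / deriv f t ^ 2 :=
      ((hd t).div (hd' t) (hf1 t)).deriv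
    rw [e]
    have := hf1 t
    field_simp
  -- The identity theorem spreads the local equation to the whole line.
  have hsq : ∀ t, deriv v t ^ 2 = k := by
    have e1 : AnalyticOnNhd ℝ (fun t => deriv v t ^ 2) Set.univ := hva.deriv.pow 2
    have e2 : AnalyticOnNhd ℝ (fun _ : ℝ => k) Set.univ := analyticOnNhd_const
    have e3 : (fun t => deriv v t ^ 2) =ᶠ[nhds s₀] fun _ => k := by
      filter_upwards [h] with s hs
      rw [hv1, ← hs]
      rfl
    intro t
    exact congrFun (e1.eq_of_eventuallyEq e2 e3) t
  have hvd : ∀ t, DifferentiableAt ℝ v t := fun t => (hva t trivial).differentiableAt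
  have hvd' : ∀ t, DifferentiableAt ℝ (deriv v) t := fun t =>
    (hva.deriv t trivial).differentiableAt
  have hv2 : ∀ t, deriv (deriv v) t = 0 := by
    intro t
    have e1 : HasDerivAt (fun t => deriv v t ^ 2) (2 * deriv v t * deriv (deriv v) t) t := by
      simpa using (hvd' t).hasDerivAt.fun_pow 2
    have e2 : (fun t => deriv v t ^ 2) = fun _ => k := funext hsq
    rw [e2] at e1
    have e3 := e1.unique (hasDerivAt_const t k)
    -- Differentiating the square gives `2 v' v'' = 0`, which yields `v'' = 0` only where `v' ≠ 0`;
    -- for `k = 0` the function `v'` is identically zero instead.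
    by_cases hk : k = 0
    · have e4 : deriv v = fun _ => 0 := funext fun t => by
        have := hsq t
        rwa [hk, pow_eq_zero_iff two_ne_zero] at this
      rw [e4]
      simp
    · have e5 : deriv v t ≠ 0 := by
        intro e
        apply hk
        rw [← hsq t, e]; ring
      simpa [e5] using e3
  have hm : ∀ t, deriv v t = deriv v 0 := fun t =>
    is_const_of_deriv_eq_zero (fun t => hvd' t) hv2 t 0
  set m := deriv v 0
  have hn : ∀ t, v t - m * t = v 0 := by
    intro t
    have e1 : ∀ t, HasDerivAt (fun t => v t - m * t) (deriv v t - m * 1) t := fun t =>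
      (hvd t).hasDerivAt.sub ((hasDerivAt_id t).const_mul m)
    have e2 := is_const_of_deriv_eq_zero (fun t => (e1 t).differentiableAt)
      (fun t => by rw [(e1 t).deriv, hm t]; ring) t 0
    simpa using e2
  have hv0 : ∀ t, v t ≠ 0 := fun t => div_ne_zero (hf0 t) (hf1 t)
  -- An affine function of nonzero slope has a zero on the line, but `v = f/f'` has none.
  have hm0 : m = 0 := by
    by_contra hm0
    apply hv0 (-(v 0) / m)
    have := hn (-(v 0) / m)
    rw [mul_div_cancel₀ _ hm0] at this
    linarith
  have hvn : ∀ t, deriv f t = (v 0)⁻¹ * f t := by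
    intro t
    have e := hn t
    rw [hm0, zero_mul, sub_zero] at e
    rw [← e, hv]
    have := hf0 t
    have := hf1 t
    field_simp
  refine ⟨f 0, (v 0)⁻¹, fun t => ?_⟩
  -- Integrating factor for `f' = f / v(0)`.
  have e1 : ∀ t, HasDerivAt (fun t => f t * Real.exp (-((v 0)⁻¹ * t)))
      (deriv f t * Real.exp (-((v 0)⁻¹ * t))
        + f t * (Real.exp (-((v 0)⁻¹ * t)) * (-((v 0)⁻¹ * 1)))) t := fun t =>
    (hd t).mul (((hasDerivAt_id t).const_mul _).neg.exp)
  have e2 := is_const_of_deriv_eq_zero (fun t => (e1 t).differentiableAt)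
    (fun t => by rw [(e1 t).deriv, hvn]; ring) t 0
  simp only [mul_zero, neg_zero, Real.exp_zero, mul_one] at e2
  rw [← e2, mul_assoc, ← Real.exp_add]
  simp

variable {φ : Fin 3 → Fin 2 → ℝ → ℝ}

/-- If `φ_{1,1}'` is not an exponential function, then `Ξ` is not locally constant anywhere. -/
theorem IsSpecialized.Xi_not_const (hφ : IsSpecialized φ)
    (hexp : ¬ ∃ b c : ℝ, ∀ t : ℝ, deriv (φ 0 0) t = b * Real.exp (c * t))
    {U : Set (Coord → ℝ)} (hU : IsOpen U) (hne : U.Nonempty) : ¬ ∃ k : ℝ, ∀ P ∈ U, Xi φ P = k := by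
  rintro ⟨k, hk⟩
  obtain ⟨P, hP⟩ := hne
  refine hexp (exists_eq_exp_of_logInvariant (k := k) (s₀ := P (x 0)) (hφ.analytic 0).deriv
    (fun t => left_ne_zero_of_mul_eq_one (hφ.deriv_mul_deriv t)) (hφ.deriv_deriv_ne_zero 0) ?_)
  -- `Ξ` depends on `x₁` only, so it suffices to vary that coordinate while staying in `U`.
  have hcont : Continuous fun s : ℝ => Function.update P (x 0) s :=
    continuous_const.update (x 0) continuous_id
  have hmem : ∀ᶠ s in nhds (P (x 0)), Function.update P (x 0) s ∈ U :=
    hcont.continuousAt.eventually_mem (hU.mem_nhds (by simpa using hP))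
  filter_upwards [hmem] with s hs
  rw [← hk _ hs, Xi_eq_logInvariant]
  simp

end Inhomogeneity

end JacobiTsankov

end

/-! ### The main theorem. -/

theorem theorem1p7 (φ : Fin 3 → Fin 2 → ℝ → ℝ) (hφ : JacobiTsankov.IsSpecialized φ) :
    -- `Ξ` is preserved by every local isometry between manifolds of the family
    (∀ ψ : Fin 3 → Fin 2 → ℝ → ℝ, JacobiTsankov.IsSpecialized ψ →
      ∀ (U : Set (JacobiTsankov.Coord → ℝ))
        (F : (JacobiTsankov.Coord → ℝ) → (JacobiTsankov.Coord → ℝ)),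
        JacobiTsankov.IsLocalIsometryOn (JacobiTsankov.gPhi φ) (JacobiTsankov.gPhi ψ) F U →
        ∀ P ∈ U, JacobiTsankov.Xi ψ (F P) = JacobiTsankov.Xi φ P) ∧
    -- `ℳ_Φ` is `0`-curvature homogeneous with model `𝔐₁₄`
    JacobiTsankov.IsZeroCurvatureHomogeneous (JacobiTsankov.gPhi φ)
      JacobiTsankov.modelForm JacobiTsankov.modelCurv ∧
    -- the case where `φ_{1,1}'` is not a pure exponential
    ((¬ ∃ b c : ℝ, ∀ t : ℝ, deriv (φ 0 0) t = b * Real.exp (c * t)) →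
      (∀ U : Set (JacobiTsankov.Coord → ℝ), IsOpen U → U.Nonempty →
        ¬ ∃ k : ℝ, ∀ P ∈ U, JacobiTsankov.Xi φ P = k) ∧
      ¬ JacobiTsankov.IsLocallyHomogeneous (JacobiTsankov.gPhi φ)) := by
  refine ⟨fun ψ hψ U F hF P hP => hφ.Xi_isometry hψ hF hP, ?_, fun hexp => ⟨fun U hU hne =>
    hφ.Xi_not_const hexp hU hne, fun hhom => ?_⟩⟩
  · rw [JacobiTsankov.gPhi_eq_linearMetric hφ]
    exact JacobiTsankov.isZeroCurvatureHomogeneous_linearMetric (hφ.contDiff 0) (hφ.contDiff 1)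
      hφ.deriv_mul_deriv
  -- Local isometries from the origin to every other point would make `Ξ` equal everywhere to its
  -- value at the origin.
  · refine hφ.Xi_not_const hexp isOpen_univ Set.univ_nonempty
      ⟨JacobiTsankov.Xi φ 0, fun Q _ => ?_⟩
    obtain ⟨U, F, hU, hF, rfl⟩ := hhom 0 Q
    exact hφ.Xi_isometry hφ hF hU
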